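/- Let $k$ be an infinite field and let $A$ be a (left and right) noetherian $k$-algebra satisfying the Nullstellensatz over $k$; that is, $A$ is a Jacobson ring (every prime factor ring of $A$ has zero Jacobson radical) and the endomorphism ring of every simple $A$-module is algebraic over $k$. Here modules are left modules, and a primitive ideal is the annihilator of a simple left module. Let $\mathcal H=(k^\times)^r$ be a torus acting rationally on $A$ by $k$-algebra automorphisms; that is, $A$ is a directed union of finite dimensional $\mathcal H$-stable subspaces $V_i$ such that the induced homomorphisms $\mathcal H\to GL(V_i)$ are morphisms of algebraic varieties (their matrix coefficients are Laurent polynomials in the coordinates of $\mathcal H$). An $\mathcal H$-prime ideal of $A$ is a proper $\mathcal H$-stable ideal $J$ such that a product of $\mathcal H$-stable ideals is contained in $J$ only when one of the factors is; $\mathcal H\text{-spec}\,A$ is the set of these. For an ideal $I$ put $(I:\mathcal H)=\bigcap_{h\in\mathcal H}h(I)$. The $\mathcal H$-stratum of $J\in\mathcal H\text{-spec}\,A$ in $\operatorname{spec}A$ is $\operatorname{spec}_JA=\{P\in\operatorname{spec}A\mid (P:\mathcal H)=J\}$, and its $\mathcal H$-stratum in the set $\operatorname{prim}A$ of primitive ideals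 is $\operatorname{prim}_JA=\operatorname{prim}A\cap\operatorname{spec}_JA$. Assume that $\mathcal H\text{-spec}\,A$ is finite and has normal $\mathcal H$-separation: for any proper inclusion $P\supsetneq Q$ of $\mathcal H$-prime ideals there is an $\mathcal H$-eigenvector $c\in P\setminus Q$ whose coset $\bar c$ is normal in $A/Q$, i.e. $\bar c(A/Q)=(A/Q)\bar c$. For a semiprime noetherian ring $R$, let $\operatorname{Fract}R$ be its ring of fractions with respect to all regular elements. Then: (a) $A$ satisfies the Dixmier–Moeglin equivalence: the following three sets of ideals coincide, namely the rational prime ideals (the primes $P$ such that the center of $\operatorname{Fract}(A/P)$ is algebraic over $k$), the locally closed prime ideals (the primes $P$ such that the intersection of all primes properly containing $P$ is strictly larger than $P$), and the primitive ideals. Moreover, the primitive ideals of $A$ are precisely the maximal elements of the $\mathcal H$-strata $\operatorname{spec}_JA$, $J\in\mathcal H\text{-spec}\,A$. (b) For every $J\in\mathcal H\text{-spec}\,A$, the fixed ring $Z(\operatorname{Fract}A/J)^{\mathcal H}$ of the center of $\operatorname{Fract}(A/J)$ under the induced action of $\mathcal H$ is a field, and it is algebraic over $k$. (c) If $k$ is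 algebraically closed, then for every $J\in\mathcal H\text{-spec}\,A$ the stratum $\operatorname{prim}_JA$ consists of a single $\mathcal H$-orbit. -/

import Mathlib

open scoped nonZeroDivisors

noncomputable section

namespace TorusStrat

universe u v

/-! ## Ideals of a noncommutative ring -/

section Ring

variable {A : Type v} [Ring A]

/-- `P` is a prime ideal of the (noncommutative) ring `A`: it is proper, and if a product `I * J`
of two-sided ideals lies in `P`, then `I` or `J` does. (`I * J ⊆ P` says that all the generating
products `a * b` lie in `P`.) -/
def IsPrimeIdeal (P : TwoSidedIdeal A) : Prop :=
  P ≠ ⊤ ∧ ∀ I J : TwoSidedIdeal A, (∀ a ∈ I, ∀ b ∈ J, a * b ∈ P) → I ≤ P ∨ J ≤ P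

variable (A) in
/-- The set `spec A` of all prime ideals. -/
def spec : Set (TwoSidedIdeal A) := {P | IsPrimeIdeal P}

/-- `P` is (left) primitive: it is the annihilator of a simple left module. -/
def IsPrimitiveIdeal (P : TwoSidedIdeal A) : Prop :=
  ∃ (M : Type v) (_ : AddCommGroup M) (_ : Module A M),
    IsSimpleModule A M ∧ ∀ a : A, a ∈ P ↔ ∀ m : M, a • m = 0

variable (A) in
/-- The set `prim A` of all primitive ideals. -/
def prim : Set (TwoSidedIdeal A) := {P | IsPrimitiveIdeal P}

/-- A prime ideal `P` is locally closed in `spec A`: the intersection of the primes properly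
containing `P` is larger than `P`. (The empty intersection is the whole ring.) -/
def IsLocallyClosedPrime (P : TwoSidedIdeal A) : Prop :=
  IsPrimeIdeal P ∧ P < sInf {Q : TwoSidedIdeal A | IsPrimeIdeal Q ∧ P < Q}

/-- `x` is a normal element of the ring: `x A = A x`. -/
def IsNormalElement (x : A) : Prop :=
  (∀ a, ∃ b, x * a = b * x) ∧ (∀ a, ∃ b, a * x = x * b)

/-- `c` is normal modulo `Q`: the coset of `c` is normal in `A / Q`. -/
def IsNormalModulo (Q : TwoSidedIdeal A) (c : A) : Prop :=
  IsNormalElement (Q.ringCon.mk' c)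

variable (A) in
/-- Noetherian means noetherian on both sides. -/
def IsTwoSidedNoetherian : Prop := IsNoetherianRing A ∧ IsNoetherianRing Aᵐᵒᵖ

variable (A) in
/-- A Jacobson ring: the Jacobson radical of every prime factor ring is zero. -/
def IsJacobson : Prop :=
  ∀ P : TwoSidedIdeal A, IsPrimeIdeal P → Ring.jacobson P.ringCon.Quotient = ⊥

end Ring

/-! ## Rings of fractions

`Fract R` is the ring of fractions of `R` with respect to all its regular elements, realised as
Mathlib's Ore localization `OreLocalization R⁰ R`. It exists when the regular elements satisfy the
Ore condition, `OreSet R⁰`; it does not depend on the choice of that datum. -/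

section Fract

variable {R : Type v} [Ring R] [OreLocalization.OreSet R⁰]

/-- The ring endomorphism of `Fract R` induced by an automorphism `e` of `R`. It sends the fraction
`s⁻¹ r` to `(e s)⁻¹ (e r)`. -/
def fractMap (e : R ≃+* R) : OreLocalization R⁰ R →+* OreLocalization R⁰ R :=
  OreLocalization.universalHom
    (OreLocalization.numeratorRingHom.comp (e : R →+* R))
    { toFun := fun s => OreLocalization.numeratorUnit
        ⟨e s,
          (MulEquivClass.map_nonZeroDivisors e).le (Submonoid.mem_map_of_mem _ s.2)⟩
      map_one' := by
        ext
        simp [OreLocalization.numeratorUnit, OreLocalization.one_def]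
      map_mul' := fun s t => by
        ext
        simp [OreLocalization.numeratorUnit] }
    (fun s => rfl)

end Fract

section Algebra

variable (k : Type u) [Field k] (A : Type v) [Ring A] [Algebra k A]

/-- The Nullstellensatz over `k`: `A` is a Jacobson ring and the endomorphism rings of all simple
`A`-modules are algebraic over `k`. (The `k`-structure of `M` is the one that comes from `A`.) -/
def SatisfiesNullstellensatz : Prop :=
  IsJacobson A ∧
    ∀ (M : Type v) [AddCommGroup M] [Module A M] [Module k M] [IsScalarTower k A M],
      IsSimpleModule A M → Algebra.IsAlgebraic k (Module.End A M)

variable {A} in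
/-- A prime ideal `P` is rational: the ring of fractions `Fract (A / P)` exists, and its center is
algebraic over `k`. -/
def IsRationalPrime (P : TwoSidedIdeal A) : Prop :=
  IsPrimeIdeal P ∧ ∃ _ : OreLocalization.OreSet (P.ringCon.Quotient)⁰,
    Algebra.IsAlgebraic k
      (Subalgebra.center k (OreLocalization (P.ringCon.Quotient)⁰ P.ringCon.Quotient))

/-- The Dixmier–Moeglin equivalence: the sets of rational prime ideals, of locally closed prime
ideals and of primitive ideals coincide. -/
def DixmierMoeglinEquivalence : Prop :=
  {P : TwoSidedIdeal A | IsRationalPrime k P} = {P | IsLocallyClosedPrime P} ∧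
    {P : TwoSidedIdeal A | IsLocallyClosedPrime P} = prim A

end Algebra

/-! ## Torus actions -/

section Action

variable {k : Type u} [Field k] {A : Type v} [Ring A] [Algebra k A]

/-- The `k`-points of the torus of rank `r`. -/
abbrev Torus (k : Type u) [Field k] (r : ℕ) : Type u := Fin r → kˣ

/-- A function on the torus is regular if it is a polynomial in the coordinates and their
inverses. -/
def IsRegularFunction {r : ℕ} (F : Torus k r → k) : Prop :=
  ∃ p : MvPolynomial (Fin r ⊕ Fin r) k, ∀ h : Torus k r,
    F h = MvPolynomial.eval
      (Sum.elim (fun i => (h i : k)) (fun i => ((h i)⁻¹ : kˣ))) p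

/-- An action of the torus by `k`-algebra automorphisms is rational: `A` is a directed union of
finite dimensional stable subspaces `V` on which the matrix coefficients of the torus are
regular functions. -/
def IsRationalAction {r : ℕ} (ρ : Torus k r →* (A ≃ₐ[k] A)) : Prop :=
  ∃ S : Set (Submodule k A), DirectedOn (· ≤ ·) S ∧ (∀ a : A, ∃ V ∈ S, a ∈ V) ∧
    ∀ V ∈ S, FiniteDimensional k V ∧
      ∃ hV : ∀ (h : Torus k r), ∀ v ∈ V, ρ h v ∈ V,
        ∀ (v : V) (φ : Module.Dual k V),
          IsRegularFunction (fun h : Torus k r => φ ⟨ρ h v, hV h v v.2⟩)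

variable {H : Type*} [Group H] (ρ : H →* (A ≃ₐ[k] A))

/-- A two-sided ideal is stable under the action. -/
def IsStable (I : TwoSidedIdeal A) : Prop := ∀ h : H, ∀ a ∈ I, ρ h a ∈ I

/-- The translate `h(I)` of a two-sided ideal. -/
def translate (h : H) (I : TwoSidedIdeal A) : TwoSidedIdeal A :=
  (ρ h : A ≃+* A).mapTwoSidedIdeal I

/-- `(I : H)`, the intersection of the orbit of `I`. -/
def core (I : TwoSidedIdeal A) : TwoSidedIdeal A := ⨅ h : H, translate ρ h I

/-- `J` is `H`-prime: it is proper and stable, and a product of stable ideals lies in `J` only if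
one of the factors does. -/
def IsHPrime (J : TwoSidedIdeal A) : Prop :=
  J ≠ ⊤ ∧ IsStable ρ J ∧ ∀ I I' : TwoSidedIdeal A, IsStable ρ I → IsStable ρ I' →
    (∀ a ∈ I, ∀ b ∈ I', a * b ∈ J) → I ≤ J ∨ I' ≤ J

/-- The set `H-spec A` of all `H`-prime ideals. -/
def HSpec : Set (TwoSidedIdeal A) := {J | IsHPrime ρ J}

/-- The `H`-stratum of `J` in `spec A`. -/
def specStratum (J : TwoSidedIdeal A) : Set (TwoSidedIdeal A) :=
  {P | P ∈ spec A ∧ core ρ P = J}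

/-- The `H`-stratum of `J` in `prim A`. -/
def primStratum (J : TwoSidedIdeal A) : Set (TwoSidedIdeal A) :=
  prim A ∩ specStratum ρ J

/-- `c` is an eigenvector of the action. -/
def IsEigenvector (c : A) : Prop := c ≠ 0 ∧ ∃ χ : H → k, ∀ h : H, ρ h c = χ h • c

/-- `H-spec A` has normal `H`-separation. -/
def HasNormalHSeparation : Prop :=
  ∀ P ∈ HSpec ρ, ∀ Q ∈ HSpec ρ, Q < P →
    ∃ c : A, c ∈ P ∧ c ∉ Q ∧ IsEigenvector ρ c ∧ IsNormalModulo Q c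

variable {ρ}

/-- The automorphism of `A / J` induced by `h`, for a stable ideal `J`. It sends the coset of `a`
to the coset of `h(a)`. -/
def quotientAut {J : TwoSidedIdeal A} (hJ : IsStable ρ J) (h : H) :
    J.ringCon.Quotient ≃ₐ[k] J.ringCon.Quotient :=
  RingCon.congrₐ k (c := J.ringCon) (d := J.ringCon) (ρ h) (by
    ext x y
    rw [RingCon.comap_rel, TwoSidedIdeal.rel_iff, TwoSidedIdeal.rel_iff, ← map_sub]
    refine ⟨fun hx => hJ h _ hx, fun hx => ?_⟩
    have h1 := hJ h⁻¹ _ hx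
    rwa [← AlgEquiv.mul_apply, ← map_mul, inv_mul_cancel, map_one, AlgEquiv.one_apply] at h1)

/-- `Z(Fract (A / J))^H`, the elements of the center of `Fract (A / J)` fixed by the induced
action, as a subring. -/
def fixedCenter {J : TwoSidedIdeal A} (hJ : IsStable ρ J)
    [OreLocalization.OreSet (J.ringCon.Quotient)⁰] :
    Subring (OreLocalization (J.ringCon.Quotient)⁰ J.ringCon.Quotient) :=
  Subring.center _ ⊓ ⨅ h : H,
    (fractMap (quotientAut hJ h : J.ringCon.Quotient ≃+* J.ringCon.Quotient)).eqLocus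
      (RingHom.id _)

end Action

end TorusStrat

end

/-!
The argument does not use normal separation. A rational torus action is a grading by the character
group; an element of an ideal `Q` outside a prime `P` with the fewest homogeneous components yields
central elements of rings of fractions, which replace the localizations at normal elements.
-/

/-! A rational torus action over an infinite field is a grading of `A` by `ℤ^r` (`weightGrading`).
Stable ideals are homogeneous, and since `ℤ^r` has unique sums, `H`-primes are prime
(`IsHPrime.isPrimeIdeal`). Goldie's theorem then provides `Fract (A / J)`, which is used only
through the properties in `IsFract`.

Part (a) is the cycle rational ⇒ maximal in its stratum ⇒ locally closed ⇒ primitive ⇒ rational. The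
last implication holds because a central fraction acts as an endomorphism of the simple module
(`IsFract.exists_end`), algebraic by the Nullstellensatz. The third is the Jacobson property, and
the second the finiteness of `H-spec A`. The heart is the first, `IsRationalPrime.maximal`. Let `Q ⊋
P` lie in the stratum of `J`, and let `u ∈ Q \ P` have the fewest homogeneous components. Minimality
makes `u_{g₀} ↦ u_g` extend to a well-defined partial bimodule map on `A / J`
(`exists_minimal_element`); such maps are multiplications by central fractions
(`IsFract.exists_central`). Summing over `g` gives a central `z ≠ 0` in `Fract (A / P)` with `z
u_{g₀} = u`. It acts as `0` modulo `Q`, because `u ∈ Q` and `u_{g₀} ∉ Q`; yet `z` is algebraic and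
invertible, so it is a root of a polynomial with nonzero constant term, a contradiction.

For (b), a fixed central fraction is a weight vector of weight `0`. The denominators of a weight
vector form a stable ideal, so they lie in no `P` of the stratum. The fraction therefore acts on a
simple module with annihilator `P`, and the resulting polynomial identity lifts from `A / P` to
`Fract (A / J)` by `IsWeightFraction.eq_zero`.

For (c), Schur's lemma makes weight vectors act by scalars modulo each primitive `P` of the stratum.
The ratio of the scalars for `P` and `P'` is a character of the group of weights. As `kˣ` is
divisible, this character comes from a torus point, and translating `P` makes the scalars equal.
Then the minimal element argument gives `P' ≤ P` (`le_of_actsByScalar`), and maximality in the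
stratum gives equality. -/

noncomputable section

namespace TorusStrat

universe u v w

/-! ## Goldie's theorem for prime noetherian rings -/

section Goldie

variable {R : Type v} [Ring R]

variable (R) in
/-- A ring is prime if `a R b = 0` only when `a = 0` or `b = 0`. -/
def IsPrimeRing : Prop := ∀ a b : R, (∀ x, a * x * b = 0) → a = 0 ∨ b = 0

/-- The left annihilator of an element. -/
def leftAnn (a : R) : Submodule R R := LinearMap.ker (LinearMap.toSpanSingleton R R a)

lemma mem_leftAnn {a x : R} : x ∈ leftAnn a ↔ x * a = 0 := by
  simp [leftAnn]

/-- Utumi's argument for Levitzki's theorem. Take a nonzero `a ∈ L` with maximal right annihilator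
(a left annihilator in `Rᵐᵒᵖ`). If `x a ≠ 0` is nilpotent, its last nonzero power has the same right
annihilator as `a`, and `x a` lies in it; so `a x a = 0` for all `x`, against primeness. -/
lemma exists_not_isNilpotent [IsNoetherianRing Rᵐᵒᵖ] (hR : IsPrimeRing R) {L : Submodule R R}
    (hL : L ≠ ⊥) : ∃ b ∈ L, ¬ IsNilpotent b := by
  by_contra! hnil
  obtain ⟨a₀, ha₀, ha₀'⟩ := L.ne_bot_iff.1 hL
  obtain ⟨_, ⟨a, ⟨haL, ha⟩, rfl⟩, hmax⟩ := set_has_maximal_iff_noetherian.2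
    (inferInstance : IsNoetherian Rᵐᵒᵖ Rᵐᵒᵖ)
    ((fun a : R => leftAnn (MulOpposite.op a)) '' {a | a ∈ L ∧ a ≠ 0}) ⟨_, a₀, ⟨ha₀, ha₀'⟩, rfl⟩
  have key : ∀ x, a * x * a = 0 := by
    intro x
    by_cases hx : x * a = 0
    · rw [mul_assoc, hx, mul_zero]
    have hn : IsNilpotent (x * a) := hnil _ (L.smul_mem x haL)
    have hxa : x * a ∈ L := L.smul_mem x haL
    classical
    obtain ⟨n, hn0, hn1⟩ : ∃ n, (x * a) ^ (n + 1) = 0 ∧ (x * a) ^ n ≠ 0 := by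
      have h1 := Nat.find_spec hn
      have h0 : Nat.find hn ≠ 0 := fun h => by
        rw [h, pow_zero] at h1
        exact hx (by rw [← one_mul (x * a), h1, zero_mul])
      refine ⟨Nat.find hn - 1, ?_, Nat.find_min hn (by omega)⟩
      rwa [Nat.sub_add_cancel (by omega)]
    have hn2 : n ≠ 0 := by
      rintro rfl
      exact hx (by simpa using hn0)
    obtain ⟨m, rfl⟩ := Nat.exists_eq_succ_of_ne_zero hn2
    have hle : leftAnn (MulOpposite.op a) ≤ leftAnn (MulOpposite.op ((x * a) ^ (m + 1))) := by
      intro y hy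
      rw [mem_leftAnn] at hy ⊢
      have hy' : a * y.unop = 0 := congrArg MulOpposite.unop hy
      apply MulOpposite.unop_injective
      change (x * a) ^ (m + 1) * y.unop = 0
      rw [pow_succ, mul_assoc, mul_assoc, hy', mul_zero, mul_zero]
    have heq := eq_of_le_of_not_lt hle
      (hmax _ ⟨_, ⟨by rw [pow_succ]; exact L.smul_mem _ hxa, hn1⟩, rfl⟩)
    have hmem : MulOpposite.op (x * a) ∈ leftAnn (MulOpposite.op ((x * a) ^ (m + 1))) := by
      rw [mem_leftAnn, ← MulOpposite.op_mul, ← pow_succ, hn0, MulOpposite.op_zero]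
    rw [← heq, mem_leftAnn, ← MulOpposite.op_mul] at hmem
    rw [mul_assoc]
    exact MulOpposite.op_injective hmem
  exact ha ((hR a a key).elim id id)

/-- The left annihilators of the powers of a non-nilpotent element stabilize, so a high power has
the same left annihilator as its square. -/
lemma exists_ne_zero_cancel_mul_self [IsNoetherianRing R] [IsNoetherianRing Rᵐᵒᵖ]
    (hR : IsPrimeRing R) {L : Submodule R R} (hL : L ≠ ⊥) :
    ∃ b ∈ L, b ≠ 0 ∧ ∀ x, x * (b * b) = 0 → x * b = 0 := by
  obtain ⟨b, hb, hnil⟩ := exists_not_isNilpotent hR hL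
  obtain ⟨n, hn⟩ := monotone_stabilizes_iff_noetherian.2 (inferInstance : IsNoetherian R R)
    ⟨fun n => leftAnn (b ^ n), monotone_nat_of_le_succ fun n x hx => by
      rw [mem_leftAnn] at hx ⊢
      rw [pow_succ, ← mul_assoc, hx, zero_mul]⟩
  refine ⟨b ^ (n + 1), by rw [pow_succ]; exact L.smul_mem _ hb, fun h => hnil ⟨_, h⟩,
    fun x hx => ?_⟩
  have h1 : x ∈ leftAnn (b ^ (n + 1 + (n + 1))) := by rwa [mem_leftAnn, pow_add]
  have h2 : leftAnn (b ^ (n + 1)) = leftAnn (b ^ (n + 1 + (n + 1))) :=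
    (hn (n + 1) (by omega)).symm.trans (hn (n + 1 + (n + 1)) (by omega))
  rwa [← h2, mem_leftAnn] at h1

/-- A left ideal is essential if it meets every nonzero left ideal. -/
def IsEssential (E : Submodule R R) : Prop := ∀ L : Submodule R R, L ≠ ⊥ → E ⊓ L ≠ ⊥

lemma IsEssential.mono {E E' : Submodule R R} (h : E ≤ E') (hE : IsEssential E) :
    IsEssential E' := fun L hL h' => hE L hL (le_bot_iff.1 ((inf_le_inf_right L h).trans h'.le))

lemma IsEssential.comap_mul {E : Submodule R R} (hE : IsEssential E) (r : R) :
    IsEssential (E.comap (LinearMap.toSpanSingleton R R r)) := by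
  intro L hL
  by_cases h : L.map (LinearMap.toSpanSingleton R R r) = ⊥
  · obtain ⟨x, hx, hx0⟩ := L.ne_bot_iff.1 hL
    refine (Submodule.ne_bot_iff _).2 ⟨x, ⟨?_, hx⟩, hx0⟩
    have : (LinearMap.toSpanSingleton R R r) x ∈ (⊥ : Submodule R R) :=
      h ▸ Submodule.mem_map_of_mem hx
    rw [Submodule.mem_bot] at this
    simp [this]
  · obtain ⟨y, ⟨hyE, hy⟩, hy0⟩ := (Submodule.ne_bot_iff _).1 (hE _ h)
    obtain ⟨x, hx, rfl⟩ := hy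
    refine (Submodule.ne_bot_iff _).2 ⟨x, ⟨hyE, hx⟩, ?_⟩
    rintro rfl
    simp at hy0

/-- A prime noetherian ring is left nonsingular. -/
lemma eq_zero_of_isEssential_leftAnn [IsNoetherianRing R] [IsNoetherianRing Rᵐᵒᵖ]
    (hR : IsPrimeRing R) {x : R} (hx : IsEssential (leftAnn x)) : x = 0 := by
  by_contra h0
  obtain ⟨b, hb, hb0, hbb⟩ := exists_ne_zero_cancel_mul_self hR
    (L := Submodule.span R {x}) (by simpa using h0)
  obtain ⟨y, rfl⟩ := Submodule.mem_span_singleton.1 hb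
  have hess : IsEssential (leftAnn (y • x)) := (hx.comap_mul y).mono fun z hz => by
    simp only [Submodule.mem_comap, LinearMap.toSpanSingleton_apply, mem_leftAnn, smul_eq_mul]
      at hz ⊢
    rw [← mul_assoc, hz]
  obtain ⟨z, ⟨hz, hz'⟩, hz0⟩ := (Submodule.ne_bot_iff _).1
    (hess (Submodule.span R {y • x}) (by simpa using hb0))
  obtain ⟨w, rfl⟩ := Submodule.mem_span_singleton.1 hz'
  apply hz0
  rw [SetLike.mem_coe, mem_leftAnn, smul_eq_mul, mul_assoc] at hz
  exact hbb w hz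

/-- If `s` is right regular, then `R s` is essential. -/
lemma isEssential_span_singleton [IsNoetherianRing R] {s : R} (hs : ∀ x, x * s = 0 → x = 0) :
    IsEssential (Submodule.span R {s}) := by
  intro L hL hbot
  -- If `R s ∩ L = 0`, this embeds `R × L` in `R`, which for noetherian `R` forces `L = 0`.
  let f : R × L →ₗ[R] R := (LinearMap.toSpanSingleton R R s).coprod L.subtype
  have hf : Function.Injective f := by
    rw [← LinearMap.ker_eq_bot, LinearMap.ker_eq_bot']
    rintro ⟨x, l⟩ h
    simp only [f, LinearMap.coprod_apply, LinearMap.toSpanSingleton_apply, smul_eq_mul,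
      Submodule.subtype_apply] at h
    have hl : (l : R) ∈ Submodule.span R {s} ⊓ L :=
      ⟨Submodule.mem_span_singleton.2 ⟨-x, by
        rw [smul_eq_mul, neg_mul]
        exact (eq_neg_of_add_eq_zero_right h).symm⟩, l.2⟩
    rw [hbot, Submodule.mem_bot] at hl
    rw [hl, add_zero] at h
    ext
    · exact hs x h
    · exact hl
  have := IsNoetherian.subsingleton_of_prod_injective f hf
  exact hL (Submodule.subsingleton_iff_eq_bot.1 this)

/-- The elements killed by the left annihilator of `c`, as a left ideal of the opposite ring. -/
def doubleAnn (c : R) : Submodule Rᵐᵒᵖ Rᵐᵒᵖ where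
  carrier := {x | ∀ y, y * c = 0 → y * x.unop = 0}
  add_mem' hx hx' y hy := by simp [mul_add, hx y hy, hx' y hy]
  zero_mem' y _ := by simp
  smul_mem' r x hx y hy := by simp [← mul_assoc, hx y hy]

/-- Take `c ∈ E` with maximal double annihilator among the elements whose left annihilator equals
that of their square. If `c` had a nonzero left annihilator, `E` would contain a `d` of the same
kind with `d c = 0`. Then `x (c + d) = 0` implies `x c = x d = 0`, so `c + d` has a larger double
annihilator. Regularity on the other side follows from nonsingularity, since `R c` is essential. -/
lemma exists_regular_of_isEssential [IsNoetherianRing R] [IsNoetherianRing Rᵐᵒᵖ]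
    (hR : IsPrimeRing R) {E : Submodule R R} (hE : IsEssential E) : ∃ c ∈ E, c ∈ R⁰ := by
  obtain ⟨_, ⟨c, ⟨hcE, hcc⟩, rfl⟩, hmax⟩ := set_has_maximal_iff_noetherian.2
    (inferInstance : IsNoetherian Rᵐᵒᵖ Rᵐᵒᵖ)
    (doubleAnn '' {c : R | c ∈ E ∧ ∀ x, x * (c * c) = 0 → x * c = 0})
    ⟨_, 0, ⟨E.zero_mem, by simp⟩, rfl⟩
  have hleft : leftAnn c = ⊥ := by
    by_contra hne
    obtain ⟨d, ⟨hdE, hdc⟩, hd0, hdd⟩ := exists_ne_zero_cancel_mul_self hR (hE _ hne)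
    rw [SetLike.mem_coe, mem_leftAnn] at hdc
    have hann : ∀ x, x * (c + d) = 0 → x * c = 0 ∧ x * d = 0 := by
      intro x hx
      have h1 : x * c = 0 := hcc x (by
        have := congrArg (· * c) hx
        simpa [mul_add, add_mul, mul_assoc, hdc] using this)
      exact ⟨h1, by rwa [mul_add, h1, zero_add] at hx⟩
    refine hmax _ ⟨c + d, ⟨E.add_mem hcE hdE, fun x hx => ?_⟩, rfl⟩ (lt_of_le_of_ne ?_ ?_)
    · have h1 : x * c = 0 := by
        have h3 : x * c * (c * c) = 0 := by
          have := congrArg (· * c) hx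
          simpa [mul_add, add_mul, mul_assoc, hdc] using this
        refine hcc x ?_
        rw [← mul_assoc]
        exact hcc _ h3
      have h2 : x * (d * d) = 0 := by
        have h3 : x * ((c + d) * (c + d)) = x * c * (c + d) + x * (d * c) + x * (d * d) := by
          noncomm_ring
        rw [hx, h1, hdc] at h3
        simpa using h3.symm
      rw [mul_add, h1, hdd x h2, add_zero]
    · exact fun x hx y hy => hx y (hann y hy).1
    · intro heq
      have hc : MulOpposite.op (c + d) ∈ doubleAnn (c + d) := fun y hy => hy
      rw [← heq] at hc
      have h1 : d * (c + d) = 0 := hc d hdc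
      rw [mul_add, hdc, zero_add] at h1
      exact hd0 (by simpa using hdd 1 (by rw [h1, mul_zero]))
  have hl : ∀ x, x * c = 0 → x = 0 := fun x hx => by
    rwa [← mem_leftAnn, hleft, Submodule.mem_bot] at hx
  refine ⟨c, hcE, ⟨fun x hx => ?_, hl⟩⟩
  refine eq_zero_of_isEssential_leftAnn hR ((isEssential_span_singleton hl).mono ?_)
  rw [Submodule.span_singleton_le_iff_mem, mem_leftAnn, hx]

/-- **Goldie's theorem**, the Ore condition: the regular elements of a prime noetherian ring form
a left Ore set. -/
theorem nonempty_oreSet_nonZeroDivisors [IsNoetherianRing R] [IsNoetherianRing Rᵐᵒᵖ]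
    (hR : IsPrimeRing R) : Nonempty (OreLocalization.OreSet R⁰) := by
  rw [OreLocalization.nonempty_oreSet_iff]
  refine ⟨fun a b s h => ⟨1, ?_⟩, fun a s => ?_⟩
  · rw [← sub_eq_zero, ← sub_mul] at h
    rw [sub_eq_zero.1 (s.2.2 _ h)]
  -- The left ideal `{x | x a ∈ R s}` is essential; a regular element `c` in it gives `c a = b s`.
  · obtain ⟨c, hc, hreg⟩ := exists_regular_of_isEssential hR
      ((isEssential_span_singleton s.2.2).comap_mul a)
    obtain ⟨b, hb⟩ := Submodule.mem_span_singleton.1 hc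
    exact ⟨b, ⟨c, hreg⟩, hb.symm⟩

/-- A nonzero ideal of a prime noetherian ring contains a regular element. -/
theorem exists_mem_nonZeroDivisors [IsNoetherianRing R] [IsNoetherianRing Rᵐᵒᵖ]
    (hR : IsPrimeRing R) {I : TwoSidedIdeal R} (hI : I ≠ ⊥) : ∃ c ∈ I, c ∈ R⁰ := by
  refine exists_regular_of_isEssential hR (E := I.asIdeal) fun L hL => ?_
  obtain ⟨l, hl, hl0⟩ := L.ne_bot_iff.1 hL
  obtain ⟨a, ha, ha0⟩ : ∃ a ∈ I, a ≠ 0 := by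
    by_contra! h
    exact hI (le_bot_iff.1 fun x hx => TwoSidedIdeal.mem_bot _ |>.2 (h x hx))
  by_contra hbot
  refine (hR a l fun x => ?_).elim ha0 hl0
  have : a * x * l ∈ I.asIdeal ⊓ L :=
    ⟨I.mul_mem_right _ _ (I.mul_mem_right _ _ ha), L.smul_mem _ hl⟩
  rwa [hbot] at this

end Goldie

/-! ## Prime and primitive ideals -/

section Ideals

variable {A : Type v} [Ring A]

lemma TwoSidedIdeal.exists_of_not_le {I J : TwoSidedIdeal A} (h : ¬ I ≤ J) : ∃ a ∈ I, a ∉ J := by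
  by_contra! h'
  exact h fun x hx => h' x hx

lemma IsPrimeIdeal.one_notMem {P : TwoSidedIdeal A} (hP : IsPrimeIdeal P) : (1 : A) ∉ P :=
  fun h => hP.1 ((TwoSidedIdeal.one_mem_iff P).1 h)

/-- The elements `d` with `a A d ⊆ P`. -/
def rightColon (P : TwoSidedIdeal A) (a : A) : TwoSidedIdeal A :=
  .mk' {d | ∀ x, a * x * d ∈ P} (fun x => by simp [P.zero_mem])
    (fun {b c} hb hc x => by rw [mul_add]; exact P.add_mem (hb x) (hc x))
    (fun {b} hb x => by rw [mul_neg]; exact P.neg_mem (hb x))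
    (fun {b c} hc x => by simpa [mul_assoc] using hc (x * b))
    (fun {b c} hb x => by rw [← mul_assoc]; exact P.mul_mem_right _ _ (hb x))

lemma mem_rightColon {P : TwoSidedIdeal A} {a d : A} :
    d ∈ rightColon P a ↔ ∀ x, a * x * d ∈ P := by
  rw [rightColon, TwoSidedIdeal.mem_mk']; rfl

/-- The elements `c` with `c I ⊆ P`. -/
def leftColon (P I : TwoSidedIdeal A) : TwoSidedIdeal A :=
  .mk' {c | ∀ d ∈ I, c * d ∈ P} (fun x => by simp [P.zero_mem])
    (fun {b c} hb hc x hx => by rw [add_mul]; exact P.add_mem (hb x hx) (hc x hx))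
    (fun {b} hb x hx => by rw [neg_mul]; exact P.neg_mem (hb x hx))
    (fun {b c} hc x hx => by rw [mul_assoc]; exact P.mul_mem_left _ _ (hc x hx))
    (fun {b c} hb x hx => by rw [mul_assoc]; exact hb _ (I.mul_mem_left _ _ hx))

lemma mem_leftColon {P I : TwoSidedIdeal A} {c : A} :
    c ∈ leftColon P I ↔ ∀ d ∈ I, c * d ∈ P := by
  rw [leftColon, TwoSidedIdeal.mem_mk']; rfl

lemma IsPrimeIdeal.mem_or_mem {P : TwoSidedIdeal A} (hP : IsPrimeIdeal P) {a b : A}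
    (h : ∀ x, a * x * b ∈ P) : a ∈ P ∨ b ∈ P := by
  refine (hP.2 (leftColon P (rightColon P a)) (rightColon P a)
    fun c hc d hd => mem_leftColon.1 hc d hd).imp (fun hle => hle ?_) (fun hle => hle ?_)
  · exact mem_leftColon.2 fun d hd => by simpa using mem_rightColon.1 hd 1
  · exact mem_rightColon.2 h

lemma IsPrimeIdeal.exists_mul_mul_notMem {P : TwoSidedIdeal A} (hP : IsPrimeIdeal P) {a b : A}
    (ha : a ∉ P) (hb : b ∉ P) : ∃ x, a * x * b ∉ P := by
  by_contra! h
  exact (hP.mem_or_mem h).elim ha hb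

lemma isPrimeIdeal_of_mem_or_mem {P : TwoSidedIdeal A} (h1 : (1 : A) ∉ P)
    (h : ∀ a b : A, (∀ x, a * x * b ∈ P) → a ∈ P ∨ b ∈ P) : IsPrimeIdeal P := by
  refine ⟨fun h' => h1 (h' ▸ TwoSidedIdeal.mem_top A), fun I J hIJ => ?_⟩
  by_contra! hne
  obtain ⟨a, ha, ha'⟩ := TwoSidedIdeal.exists_of_not_le hne.1
  obtain ⟨b, hb, hb'⟩ := TwoSidedIdeal.exists_of_not_le hne.2
  exact (h a b fun x => hIJ _ (I.mul_mem_right _ _ ha) _ hb).elim ha' hb'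

/-- A prime containing none of finitely many ideals does not contain their product. Applied to
`H`-primes, this turns the finiteness of `H-spec A` into a single separating element. -/
lemma IsPrimeIdeal.exists_mem_of_finite {P : TwoSidedIdeal A} (hP : IsPrimeIdeal P)
    {S : Set (TwoSidedIdeal A)} (hS : S.Finite) (h : ∀ I ∈ S, ¬ I ≤ P) :
    ∃ a ∉ P, ∀ I ∈ S, a ∈ I := by
  induction S, hS using Set.Finite.induction_on with
  | empty => exact ⟨1, hP.one_notMem, by simp⟩
  | @insert I S _ _ ih =>
    obtain ⟨a, ha, haS⟩ := ih fun I hI => h I (Set.mem_insert_of_mem _ hI)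
    obtain ⟨b, hb, hbP⟩ := TwoSidedIdeal.exists_of_not_le (h I (Set.mem_insert _ _))
    obtain ⟨x, hx⟩ := hP.exists_mul_mul_notMem ha hbP
    refine ⟨_, hx, fun I' hI' => ?_⟩
    rcases hI' with rfl | hI'
    · exact TwoSidedIdeal.mul_mem_left _ _ _ hb
    · exact I'.mul_mem_right _ _ (I'.mul_mem_right _ _ (haS I' hI'))

/-- The annihilator of a simple module is prime. -/
lemma isPrimeIdeal_of_isSimpleModule {P : TwoSidedIdeal A} {M : Type w} [AddCommGroup M]
    [Module A M] [IsSimpleModule A M] (hP : ∀ a : A, a ∈ P ↔ ∀ m : M, a • m = 0) :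
    IsPrimeIdeal P := by
  have := IsSimpleModule.nontrivial A M
  refine isPrimeIdeal_of_mem_or_mem (fun h1 => ?_) fun a b hab => ?_
  · obtain ⟨m, hm⟩ := exists_ne (0 : M)
    exact hm (by simpa using (hP 1).1 h1 m)
  · rw [or_iff_not_imp_right]
    intro hb
    rw [hP] at hb
    push Not at hb
    obtain ⟨m, hm⟩ := hb
    refine (hP a).2 fun m' => ?_
    have htop := IsSimpleModule.span_singleton_eq_top A hm
    obtain ⟨x, rfl⟩ := Submodule.mem_span_singleton.1 (htop ▸ Submodule.mem_top : m' ∈ _)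
    simpa [mul_smul] using (hP _).1 (hab x) m

lemma IsPrimitiveIdeal.isPrimeIdeal {P : TwoSidedIdeal A} (hP : IsPrimitiveIdeal P) :
    IsPrimeIdeal P := by
  obtain ⟨M, _, _, _, h⟩ := hP
  exact isPrimeIdeal_of_isSimpleModule h

variable (A) in
/-- The annihilator of a module, as a two-sided ideal. -/
def annIdeal (M : Type w) [AddCommGroup M] [Module A M] : TwoSidedIdeal A :=
  .mk' {x | ∀ m : M, x • m = 0} (by simp)
    (fun {b c} hb hc y => by rw [add_smul, hb y, hc y, add_zero])
    (fun {b} hb y => by rw [neg_smul, hb y, neg_zero])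
    (fun {b c} hc y => by rw [mul_smul, hc y, smul_zero])
    (fun {b c} hb y => by rw [mul_smul, hb])

lemma mem_annIdeal {M : Type w} [AddCommGroup M] [Module A M] {a : A} :
    a ∈ annIdeal A M ↔ ∀ m : M, a • m = 0 := by
  rw [annIdeal, TwoSidedIdeal.mem_mk']; rfl

/-- The pullback of a primitive ideal along a surjection is primitive. -/
lemma isPrimitiveIdeal_of_surjective {B : Type v} [Ring B] {f : A →+* B}
    (hf : Function.Surjective f) {P : TwoSidedIdeal A} {Q : TwoSidedIdeal B}
    (hQ : IsPrimitiveIdeal Q) (hPQ : ∀ a, a ∈ P ↔ f a ∈ Q) : IsPrimitiveIdeal P := by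
  obtain ⟨M, _, _, hM, hQM⟩ := hQ
  let _ : Module A M := Module.compHom M f
  have hsmul : ∀ (x : A) (y : M), x • y = f x • y := fun _ _ => rfl
  have := IsSimpleModule.nontrivial B M
  refine ⟨M, inferInstance, inferInstance, isSimpleModule_iff_toSpanSingleton_surjective.2
    ⟨this, fun y hy z => ?_⟩, fun a => by simp only [hPQ, hQM, hsmul]⟩
  obtain ⟨x, hx⟩ := (isSimpleModule_iff_toSpanSingleton_surjective.1 hM).2 y hy z
  obtain ⟨x, rfl⟩ := hf x
  exact ⟨x, hx⟩

/-- In a Jacobson ring every prime ideal is an intersection of primitive ideals. -/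
lemma IsJacobson.exists_isPrimitiveIdeal (hA : IsJacobson A) {P : TwoSidedIdeal A}
    (hP : IsPrimeIdeal P) {a : A} (ha : a ∉ P) :
    ∃ P', IsPrimitiveIdeal P' ∧ P ≤ P' ∧ a ∉ P' := by
  let π := P.ringCon.mk'
  have hπ : ∀ x, π x = 0 ↔ x ∈ P := fun x => by
    rw [← TwoSidedIdeal.mem_ker, TwoSidedIdeal.ker_ringCon_mk']
  have hmem : π a ∉ Ring.jacobson P.ringCon.Quotient := by
    rw [hA P hP, Submodule.mem_bot, hπ]
    exact ha
  rw [Ring.jacobson, Module.jacobson, Submodule.mem_sInf] at hmem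
  push Not at hmem
  obtain ⟨m, hm, ham⟩ := hmem
  have hsimple : IsSimpleModule P.ringCon.Quotient (P.ringCon.Quotient ⧸ m) :=
    isSimpleModule_iff_isCoatom.2 hm
  have hQ : IsPrimitiveIdeal (annIdeal P.ringCon.Quotient (P.ringCon.Quotient ⧸ m)) :=
    ⟨_, inferInstance, inferInstance, hsimple, fun x => mem_annIdeal⟩
  refine ⟨(annIdeal P.ringCon.Quotient (P.ringCon.Quotient ⧸ m)).comap π,
    isPrimitiveIdeal_of_surjective P.ringCon.mk'_surjective hQ
      fun x => TwoSidedIdeal.mem_comap _, fun x hx => ?_, fun h => ?_⟩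
  · rw [TwoSidedIdeal.mem_comap, (hπ x).2 hx]
    exact TwoSidedIdeal.zero_mem _
  · rw [TwoSidedIdeal.mem_comap, mem_annIdeal] at h
    have h1 := h (Submodule.Quotient.mk 1)
    rw [← Submodule.Quotient.mk_smul, Submodule.Quotient.mk_eq_zero, smul_eq_mul, mul_one] at h1
    exact ham h1

/-- Take an element outside `P` that lies in every larger prime. A primitive ideal over `P` that
misses it can only be `P`. -/
lemma IsLocallyClosedPrime.isPrimitiveIdeal (hA : IsJacobson A) {P : TwoSidedIdeal A}
    (hP : IsLocallyClosedPrime P) : IsPrimitiveIdeal P := by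
  obtain ⟨a, ha, haP⟩ := TwoSidedIdeal.exists_of_not_le hP.2.not_ge
  obtain ⟨P', hP', hle, ha'⟩ := hA.exists_isPrimitiveIdeal hP.1 haP
  rcases hle.eq_or_lt with rfl | hlt
  · exact hP'
  · exact (ha' (TwoSidedIdeal.mem_sInf A |>.1 ha _ ⟨hP'.isPrimeIdeal, hlt⟩)).elim

end Ideals

/-! ## Central elements of rings of fractions -/

section IsFract

variable {k : Type u} [Field k] {A : Type v} [Ring A] [Algebra k A]

/-- The properties that are used of the map `ψ` from `A` to the ring of fractions of `A / J`. -/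
structure IsFract {F : Type w} [Ring F] [Algebra k F] (J : TwoSidedIdeal A) (ψ : A →ₐ[k] F) :
    Prop where
  map_eq_zero_iff : ∀ a, ψ a = 0 ↔ a ∈ J
  exists_denominator : ∀ z, ∃ s b, IsUnit (ψ s) ∧ ψ s * z = ψ b
  exists_isUnit : ∀ I : TwoSidedIdeal A, ¬ I ≤ J → ∃ s ∈ I, IsUnit (ψ s)

/-- The map from `A` to the ring of fractions of `A / J`. -/
def toFract (k : Type u) [Field k] [Algebra k A] (J : TwoSidedIdeal A)
    [OreLocalization.OreSet (J.ringCon.Quotient)⁰] :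
    A →ₐ[k] OreLocalization (J.ringCon.Quotient)⁰ J.ringCon.Quotient where
  __ := (OreLocalization.numeratorRingHom (S := (J.ringCon.Quotient)⁰)).comp J.ringCon.mk'
  commutes' _ := rfl

lemma mk'_eq_zero_iff {J : TwoSidedIdeal A} {a : A} : J.ringCon.mk' a = 0 ↔ a ∈ J := by
  rw [← TwoSidedIdeal.mem_ker, TwoSidedIdeal.ker_ringCon_mk']

lemma IsTwoSidedNoetherian.quotient (hA : IsTwoSidedNoetherian A) (J : TwoSidedIdeal A) :
    IsTwoSidedNoetherian J.ringCon.Quotient := by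
  obtain ⟨_, _⟩ := hA
  refine ⟨isNoetherianRing_of_surjective _ _ J.ringCon.mk' J.ringCon.mk'_surjective,
    isNoetherianRing_of_surjective _ _ J.ringCon.mk'.op fun x => ?_⟩
  obtain ⟨a, ha⟩ := J.ringCon.mk'_surjective x.unop
  exact ⟨MulOpposite.op a, MulOpposite.unop_injective ha⟩

lemma IsPrimeIdeal.isPrimeRing_quotient {J : TwoSidedIdeal A} (hJ : IsPrimeIdeal J) :
    IsPrimeRing J.ringCon.Quotient := by
  intro a b h
  obtain ⟨a, rfl⟩ := J.ringCon.mk'_surjective a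
  obtain ⟨b, rfl⟩ := J.ringCon.mk'_surjective b
  rw [mk'_eq_zero_iff, mk'_eq_zero_iff]
  refine hJ.mem_or_mem fun x => ?_
  rw [← mk'_eq_zero_iff, map_mul, map_mul]
  exact h _

lemma IsPrimeIdeal.nonempty_oreSet (hA : IsTwoSidedNoetherian A) {J : TwoSidedIdeal A}
    (hJ : IsPrimeIdeal J) : Nonempty (OreLocalization.OreSet (J.ringCon.Quotient)⁰) := by
  obtain ⟨_, _⟩ := hA.quotient J
  exact nonempty_oreSet_nonZeroDivisors hJ.isPrimeRing_quotient

lemma isFract_toFract (hA : IsTwoSidedNoetherian A) {J : TwoSidedIdeal A} (hJ : IsPrimeIdeal J)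
    [OreLocalization.OreSet (J.ringCon.Quotient)⁰] : IsFract J (toFract k J) where
  map_eq_zero_iff a := by
    rw [← mk'_eq_zero_iff (J := J)]
    have hinj := OreLocalization.numeratorHom_inj (S := (J.ringCon.Quotient)⁰) inf_le_left
    refine ⟨fun h => hinj ?_, fun h => ?_⟩
    · exact h.trans (map_zero (OreLocalization.numeratorRingHom
        (S := (J.ringCon.Quotient)⁰))).symm
    · change OreLocalization.numeratorRingHom (J.ringCon.mk' a) = 0
      rw [h, map_zero]
  exists_denominator z := by
    induction z using OreLocalization.ind with | _ r s
    obtain ⟨a, ha⟩ := J.ringCon.mk'_surjective s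
    obtain ⟨b, rfl⟩ := J.ringCon.mk'_surjective r
    refine ⟨a, b, ?_, ?_⟩
    · change IsUnit (OreLocalization.numeratorHom (J.ringCon.mk' a))
      rw [ha]
      exact OreLocalization.numerator_isUnit s
    · change (J.ringCon.mk' a) /ₒ 1 * _ = (J.ringCon.mk' b) /ₒ 1
      rw [ha, OreLocalization.mul_cancel]
  exists_isUnit I hI := by
    obtain ⟨_, _⟩ := hA.quotient J
    let I' : TwoSidedIdeal J.ringCon.Quotient := .mk' (J.ringCon.mk' '' I)
      ⟨0, I.zero_mem, map_zero _⟩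
      (by rintro _ _ ⟨x, hx, rfl⟩ ⟨y, hy, rfl⟩; exact ⟨x + y, I.add_mem hx hy, map_add _ _ _⟩)
      (by rintro _ ⟨x, hx, rfl⟩; exact ⟨-x, I.neg_mem hx, map_neg _ _⟩)
      (by
        rintro y _ ⟨x, hx, rfl⟩
        obtain ⟨y, rfl⟩ := J.ringCon.mk'_surjective y
        exact ⟨y * x, I.mul_mem_left _ _ hx, map_mul _ _ _⟩)
      (by
        rintro _ y ⟨x, hx, rfl⟩
        obtain ⟨y, rfl⟩ := J.ringCon.mk'_surjective y
        exact ⟨x * y, I.mul_mem_right _ _ hx, map_mul _ _ _⟩)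
    have hI' : ∀ x, x ∈ I' ↔ x ∈ J.ringCon.mk' '' I := fun x =>
      TwoSidedIdeal.mem_mk' ..
    obtain ⟨c, hc, hreg⟩ := exists_mem_nonZeroDivisors hJ.isPrimeRing_quotient (I := I') (by
      obtain ⟨a, ha, haJ⟩ := TwoSidedIdeal.exists_of_not_le hI
      intro hbot
      have : J.ringCon.mk' a ∈ I' := (hI' _).2 ⟨a, ha, rfl⟩
      rw [hbot, TwoSidedIdeal.mem_bot, mk'_eq_zero_iff] at this
      exact haJ this)
    obtain ⟨a, ha, rfl⟩ := (hI' c).1 hc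
    exact ⟨a, ha, OreLocalization.numerator_isUnit (⟨_, hreg⟩ : (J.ringCon.Quotient)⁰)⟩

variable {F : Type w} [Ring F] [Algebra k F] {J : TwoSidedIdeal A} {ψ : A →ₐ[k] F}

lemma IsFract.map_eq_map_iff (h : IsFract J ψ) {a b : A} : ψ a = ψ b ↔ a - b ∈ J := by
  rw [← sub_eq_zero, ← map_sub, h.map_eq_zero_iff]

lemma mul_comm_of_mem_center {z : F} (hz : z ∈ Subalgebra.center k F) (x : F) :
    x * z = z * x := Subalgebra.mem_center_iff.1 hz x

/-- The denominators of a central fraction. -/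
def denominators {z : F} (ψ : A →ₐ[k] F) (hz : z ∈ Subalgebra.center k F) : TwoSidedIdeal A :=
  .mk' {d | ∃ b, z * ψ d = ψ b} ⟨0, by simp⟩
    (fun {c d} ⟨b, hb⟩ ⟨b', hb'⟩ => ⟨b + b', by rw [map_add, mul_add, hb, hb', map_add]⟩)
    (fun {d} ⟨b, hb⟩ => ⟨-b, by rw [map_neg, mul_neg, hb, map_neg]⟩)
    (fun {c d} ⟨b, hb⟩ => ⟨c * b, by
      rw [map_mul, ← mul_assoc, ← mul_comm_of_mem_center hz, mul_assoc, hb, map_mul]⟩)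
    (fun {c d} ⟨b, hb⟩ => ⟨b * d, by rw [map_mul, ← mul_assoc, hb, map_mul]⟩)

lemma mem_denominators {z : F} {hz : z ∈ Subalgebra.center k F} {d : A} :
    d ∈ denominators ψ hz ↔ ∃ b, z * ψ d = ψ b := by
  rw [denominators, TwoSidedIdeal.mem_mk']; rfl

lemma IsFract.denominators_not_le (h : IsFract J ψ) (hJ : IsPrimeIdeal J) {z : F}
    (hz : z ∈ Subalgebra.center k F) : ¬ denominators ψ hz ≤ J := by
  obtain ⟨s, b, ⟨u, hu⟩, hsb⟩ := h.exists_denominator z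
  intro hle
  have hs : s ∈ J := hle (mem_denominators.2 ⟨b, by rw [← mul_comm_of_mem_center hz, hsb]⟩)
  rw [← h.map_eq_zero_iff, ← hu] at hs
  have h1 : ψ 1 = 0 := by
    rw [map_one, ← Units.mul_inv u, hs, zero_mul]
  exact hJ.one_notMem ((h.map_eq_zero_iff _).1 h1)

/-- A nonzero central fraction annihilates no nonzero element. -/
lemma IsFract.eq_zero_of_mul_eq_zero (h : IsFract J ψ) (hJ : IsPrimeIdeal J) {z : F}
    (hz : z ∈ Subalgebra.center k F) {d : A} (hd : d ∉ J) (h0 : z * ψ d = 0) : z = 0 := by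
  obtain ⟨s, b, hs, hsb⟩ := h.exists_denominator z
  rw [← hs.mul_right_eq_zero, hsb, h.map_eq_zero_iff]
  -- With `ψ s * z = ψ b`, centrality gives `ψ (b x d) = ψ (s) ψ (x) z ψ (d) = 0`, so `b A d ⊆ J`.
  refine (hJ.mem_or_mem fun x => ?_).resolve_right hd
  rw [← h.map_eq_zero_iff, map_mul, map_mul, ← hsb, mul_assoc _ z, ← mul_comm_of_mem_center hz,
    mul_assoc, mul_assoc, h0, mul_zero, mul_zero]

/-- A nonzero central fraction is invertible. -/
lemma IsFract.isUnit_of_mem_center (h : IsFract J ψ) (hJ : IsPrimeIdeal J) {z : F}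
    (hz : z ∈ Subalgebra.center k F) (h0 : z ≠ 0) : IsUnit z := by
  -- The ideal of elements of `A` that are multiples of `z` in `F` by elements of `A`. It is not
  -- inside `J`, so it contains a unit of `F`.
  let N : TwoSidedIdeal A := .mk' {b | ∃ d, z * ψ d = ψ b} ⟨0, by simp⟩
    (fun {c d} ⟨b, hb⟩ ⟨b', hb'⟩ => ⟨b + b', by rw [map_add, mul_add, hb, hb', map_add]⟩)
    (fun {d} ⟨b, hb⟩ => ⟨-b, by rw [map_neg, mul_neg, hb, map_neg]⟩)
    (fun {c d} ⟨b, hb⟩ => ⟨c * b, by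
      rw [map_mul, ← mul_assoc, ← mul_comm_of_mem_center hz, mul_assoc, hb, map_mul]⟩)
    (fun {c d} ⟨b, hb⟩ => ⟨b * d, by rw [map_mul, ← mul_assoc, hb, map_mul]⟩)
  have hN : ∀ b, b ∈ N ↔ ∃ d, z * ψ d = ψ b := fun b => by rw [TwoSidedIdeal.mem_mk']; rfl
  obtain ⟨s, hs, u, hu⟩ := h.exists_isUnit N (by
    obtain ⟨d, hd, hdJ⟩ := TwoSidedIdeal.exists_of_not_le (h.denominators_not_le hJ hz)
    obtain ⟨b, hb⟩ := mem_denominators.1 hd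
    intro hle
    have hbJ : b ∈ J := hle ((hN b).2 ⟨d, hb⟩)
    rw [← h.map_eq_zero_iff, ← hb] at hbJ
    exact h0 (h.eq_zero_of_mul_eq_zero hJ hz hdJ hbJ))
  obtain ⟨d, hd⟩ := (hN s).1 hs
  have hz1 : z * (ψ d * ↑u⁻¹) = 1 := by rw [← mul_assoc, hd, ← hu, Units.mul_inv]
  exact ⟨⟨z, ψ d * ↑u⁻¹, hz1, by rw [mul_comm_of_mem_center hz, hz1]⟩, rfl⟩

/-- A fraction that commutes with `A` is central. -/
lemma IsFract.mem_center (h : IsFract J ψ) {z : F} (hz : ∀ a, ψ a * z = z * ψ a) :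
    z ∈ Subalgebra.center k F := by
  refine Subalgebra.mem_center_iff.2 fun w => ?_
  obtain ⟨s, b, hs, hsb⟩ := h.exists_denominator w
  rw [← hs.mul_right_inj, ← mul_assoc, hsb, hz, ← hsb, ← mul_assoc, ← mul_assoc, hz]

/-- A homomorphism from a subbimodule of `A` to `A / J`, given by its graph, is the multiplication
by a central fraction. -/
lemma IsFract.exists_central (h : IsFract J ψ) (T : AddSubgroup (A × A))
    (hleft : ∀ (a : A), ∀ t ∈ T, (a * t.1, a * t.2) ∈ T)
    (hright : ∀ (a : A), ∀ t ∈ T, (t.1 * a, t.2 * a) ∈ T)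
    (hT : ∀ t ∈ T, t.1 ∈ J → t.2 ∈ J) (hne : ∃ t ∈ T, t.1 ∉ J) :
    ∃ z ∈ Subalgebra.center k F, ∀ t ∈ T, z * ψ t.1 = ψ t.2 := by
  let I : TwoSidedIdeal A := .mk' {x | ∃ y, (x, y) ∈ T} ⟨0, T.zero_mem⟩
    (fun {c d} ⟨b, hb⟩ ⟨b', hb'⟩ => ⟨b + b', T.add_mem hb hb'⟩)
    (fun {d} ⟨b, hb⟩ => ⟨-b, T.neg_mem hb⟩)
    (fun {c d} ⟨b, hb⟩ => ⟨c * b, hleft c _ hb⟩)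
    (fun {c d} ⟨b, hb⟩ => ⟨b * d, hright d _ hb⟩)
  have hI : ∀ b, b ∈ I ↔ ∃ y, (b, y) ∈ T := fun b => by rw [TwoSidedIdeal.mem_mk']; rfl
  obtain ⟨x, hx, u, hu⟩ := h.exists_isUnit I (by
    obtain ⟨⟨x, y⟩, ht, hx⟩ := hne
    exact fun hle => hx (hle ((hI x).2 ⟨y, ht⟩)))
  obtain ⟨y, hxy⟩ := (hI x).1 hx
  have hcomm : ∀ t ∈ T, ψ x * ψ t.2 = ψ y * ψ t.1 := by
    intro t ht
    rw [← map_mul, ← map_mul, h.map_eq_map_iff]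
    -- The pairs `x · t` and `(x, y) · t.1` have the same first coordinate, so their second
    -- coordinates agree modulo `J`.
    refine hT (x * t.1 - x * t.1, x * t.2 - y * t.1)
      (T.sub_mem (hleft x t ht) (hright t.1 _ hxy)) ?_
    rw [sub_self]
    exact J.zero_mem
  have hz : ∀ t ∈ T, ↑u⁻¹ * ψ y * ψ t.1 = ψ t.2 := fun t ht => by
    rw [mul_assoc, ← hcomm t ht, ← hu, Units.inv_mul_cancel_left]
  have hA : ∀ a : A, ψ a * (↑u⁻¹ * ψ y) = ↑u⁻¹ * ψ y * ψ a := by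
    intro a
    have h1 : ↑u⁻¹ * ψ y * (ψ a * ψ x) = ψ a * ψ y := by
      rw [← map_mul, ← map_mul]
      exact hz _ (hleft a _ hxy)
    have h2 : ↑u⁻¹ * ψ y * ψ x = ψ y := hz _ hxy
    rw [← Units.mul_left_inj u, hu, mul_assoc, h2, mul_assoc, h1]
  exact ⟨↑u⁻¹ * ψ y, h.mem_center hA, hz⟩

end IsFract

/-! ## Central fractions acting on modules -/

section Compatible

open Polynomial

variable {k : Type u} [Field k] {A : Type v} [Ring A] [Algebra k A]
variable {F : Type*} [Ring F] [Algebra k F] {J : TwoSidedIdeal A} {ψ : A →ₐ[k] F}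
variable {M : Type w} [AddCommGroup M] [Module A M]

lemma aeval_center {z : F} (hz : z ∈ Subalgebra.center k F) (p : k[X]) :
    Polynomial.aeval z p = (Polynomial.aeval (⟨z, hz⟩ : Subalgebra.center k F) p : F) :=
  Polynomial.aeval_algHom_apply (Subalgebra.center k F).val
    (⟨z, hz⟩ : Subalgebra.center k F) p

/-- The endomorphism `e` agrees with the multiplication by `z` on `d M`. -/
def AgreesAt (ψ : A →ₐ[k] F) (z : F) (e : Module.End A M) (d : A) : Prop :=
  ∃ b, z * ψ d = ψ b ∧ ∀ m : M, e (d • m) = b • m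

lemma AgreesAt.mul_left {z : F} (hz : z ∈ Subalgebra.center k F) {e : Module.End A M} {d : A}
    (h : AgreesAt ψ z e d) (x : A) : AgreesAt ψ z e (x * d) := by
  obtain ⟨b, hb, he⟩ := h
  refine ⟨x * b, ?_, fun m => by rw [mul_smul, map_smul, he, mul_smul]⟩
  rw [map_mul, ← mul_assoc, ← mul_comm_of_mem_center hz, mul_assoc, hb, map_mul]

/-- The endomorphism `e` agrees with the multiplication by `z` outside `Q`. -/
def Agrees (ψ : A →ₐ[k] F) (Q : TwoSidedIdeal A) (z : F) (e : Module.End A M) : Prop :=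
  ∃ d ∉ Q, AgreesAt ψ z e d

variable {Q : TwoSidedIdeal A}

/-- For `d` and `d'` outside the prime `Q`, some `d x d'` is outside `Q`, and it is a common
denominator because denominators form an ideal. -/
lemma Agrees.add (hQ : IsPrimeIdeal Q) {z z' : F} (hz' : z' ∈ Subalgebra.center k F)
    {e e' : Module.End A M} (h : Agrees ψ Q z e) (h' : Agrees ψ Q z' e') :
    Agrees ψ Q (z + z') (e + e') := by
  obtain ⟨d, hd, b, hb, he⟩ := h
  obtain ⟨d', hd', h2⟩ := h'
  obtain ⟨x, hx⟩ := hQ.exists_mul_mul_notMem hd hd'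
  obtain ⟨b', hb', he'⟩ := h2.mul_left hz' (d * x)
  refine ⟨_, hx, b * x * d' + b', ?_, fun m => ?_⟩
  · rw [add_mul, hb', mul_assoc d, map_mul, ← mul_assoc, hb, map_add, mul_assoc b, map_mul ψ b]
  · rw [LinearMap.add_apply, he', add_smul, mul_assoc d, mul_smul d, he, ← mul_smul, mul_assoc b]

lemma Agrees.mul (hQ : IsPrimeIdeal Q) {z z' : F} (hz' : z' ∈ Subalgebra.center k F)
    {e e' : Module.End A M} (h : Agrees ψ Q z e) (h' : Agrees ψ Q z' e') :
    Agrees ψ Q (z * z') (e * e') := by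
  obtain ⟨d, hd, b, hb, he⟩ := h
  obtain ⟨d', hd', h2⟩ := h'
  obtain ⟨x, hx⟩ := hQ.exists_mul_mul_notMem hd hd'
  obtain ⟨b', hb', he'⟩ := h2.mul_left hz' x
  refine ⟨_, hx, b * b', ?_, fun m => ?_⟩
  · rw [mul_assoc d, map_mul, mul_assoc z, ← mul_assoc z', ← mul_comm_of_mem_center hz' (ψ d),
      mul_assoc, hb', ← mul_assoc, hb, map_mul]
  · rw [Module.End.mul_apply, mul_assoc d, mul_smul d, map_smul e', he', he, mul_smul]

/-- A central fraction acts on every simple module that its denominators do not annihilate. -/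
lemma IsFract.exists_end [IsSimpleModule A M] (h : IsFract J ψ)
    (hP : ∀ a : A, a ∈ Q ↔ ∀ m : M, a • m = 0) (hJQ : J ≤ Q) {z : F}
    (hz : z ∈ Subalgebra.center k F) (hd : ¬ denominators ψ hz ≤ Q) :
    ∃ e : Module.End A M, ∀ d b, z * ψ d = ψ b → ∀ m, e (d • m) = b • m := by
  -- The graph of the desired endomorphism, the pairs `(m, z m)`, written without dividing. By
  -- simplicity of `M`, its first projection is bijective.
  let G : Submodule A (M × M) :=
    { carrier := {t | ∀ d b, z * ψ d = ψ b → d • t.2 = b • t.1}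
      add_mem' := fun {s t} hs ht d b hb => by
        rw [Prod.snd_add, Prod.fst_add, smul_add, smul_add, hs d b hb, ht d b hb]
      zero_mem' := fun d b _ => by simp
      smul_mem' := fun a t ht d b hb => by
        rw [Prod.smul_snd, Prod.smul_fst, ← mul_smul, ← mul_smul]
        exact ht _ _ (by rw [map_mul, ← mul_assoc, hb, map_mul]) }
  have hmem : ∀ d b, z * ψ d = ψ b → ∀ m : M, (d • m, b • m) ∈ G := by
    intro d b hb m d' b' hb'
    simp only
    rw [← mul_smul, ← mul_smul, ← sub_eq_zero, ← sub_smul]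
    refine (hP _).1 (hJQ (h.map_eq_map_iff.1 ?_)) m
    rw [map_mul, map_mul, ← hb, ← hb', ← mul_assoc, mul_comm_of_mem_center hz]
  obtain ⟨d₀, hd₀, hd₀Q⟩ := TwoSidedIdeal.exists_of_not_le hd
  obtain ⟨b₀, hb₀⟩ := mem_denominators.1 hd₀
  rw [hP] at hd₀Q
  push Not at hd₀Q
  obtain ⟨m₀, hm₀⟩ := hd₀Q
  let π : G →ₗ[A] M := LinearMap.fst A M M ∘ₗ G.subtype
  have hsurj : Function.Surjective π := by
    rw [← LinearMap.range_eq_top]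
    refine (eq_bot_or_eq_top _).resolve_left fun hbot => hm₀ ?_
    have : π ⟨_, hmem d₀ b₀ hb₀ m₀⟩ ∈ LinearMap.range π := LinearMap.mem_range_self _ _
    rw [hbot, Submodule.mem_bot] at this
    exact this
  -- The vectors killed by all denominators measure the failure of uniqueness of `z m`. They form a
  -- proper submodule, as `d₀` does not kill `m₀`.
  let K : Submodule A M :=
    { carrier := {m | ∀ d b, z * ψ d = ψ b → d • m = 0}
      add_mem' := fun {s t} hs ht d b hb => by rw [smul_add, hs d b hb, ht d b hb, add_zero]
      zero_mem' := fun d b _ => by simp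
      smul_mem' := fun a t ht d b hb => by
        rw [← mul_smul]
        exact ht _ (b * a) (by rw [map_mul, ← mul_assoc, hb, map_mul]) }
  have hK : K = ⊥ := by
    refine (eq_bot_or_eq_top _).resolve_right fun htop => hm₀ ?_
    have : m₀ ∈ K := htop ▸ Submodule.mem_top
    exact this d₀ b₀ hb₀
  have hinj : Function.Injective π := by
    rw [← LinearMap.ker_eq_bot, LinearMap.ker_eq_bot']
    rintro ⟨⟨m, m'⟩, hG⟩ hm
    have hm0 : m = 0 := hm
    have : m' ∈ K := fun d b hb => by
      have := hG d b hb
      simpa [hm0] using this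
    rw [hK, Submodule.mem_bot] at this
    ext
    · exact hm0
    · exact this
  let E := LinearEquiv.ofBijective π ⟨hinj, hsurj⟩
  refine ⟨LinearMap.snd A M M ∘ₗ G.subtype ∘ₗ E.symm.toLinearMap, fun d b hb m => ?_⟩
  have : E.symm (d • m) = ⟨_, hmem d b hb m⟩ := by
    rw [LinearEquiv.symm_apply_eq]
    rfl
  change (E.symm (d • m) : M × M).2 = b • m
  rw [this]

variable [Module k M] [IsScalarTower k A M]

lemma agrees_algebraMap (hQ : IsPrimeIdeal Q) (c : k) :
    Agrees ψ Q (algebraMap k F c) (algebraMap k (Module.End A M) c) := by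
  refine ⟨1, hQ.one_notMem, algebraMap k A c, by rw [map_one, mul_one, AlgHom.commutes],
    fun m => ?_⟩
  rw [one_smul, algebraMap_smul, Module.algebraMap_end_apply]

lemma Agrees.aeval (hQ : IsPrimeIdeal Q) {z : F} (hz : z ∈ Subalgebra.center k F)
    {e : Module.End A M} (h : Agrees ψ Q z e) (p : k[X]) :
    Agrees ψ Q (aeval z p) (aeval e p) := by
  have hmem : ∀ q : k[X], Polynomial.aeval z q ∈ Subalgebra.center k F := fun q => by
    rw [aeval_center hz]
    exact SetLike.coe_mem _
  induction p using Polynomial.induction_on with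
  | C a => simpa using agrees_algebraMap hQ a
  | add p q hp hq => simpa using hp.add hQ (hmem q) hq
  | monomial n a ih =>
    rw [pow_succ, ← mul_assoc, map_mul, map_mul (Polynomial.aeval e), aeval_X, aeval_X]
    exact ih.mul hQ hz h

/-- If the algebraic endomorphism `e` agrees with the multiplication by `z`, then a nonzero
polynomial in `z` agrees with `0`. -/
lemma Agrees.exists_polynomial (hQ : IsPrimeIdeal Q) {z : F} (hz : z ∈ Subalgebra.center k F)
    {e : Module.End A M} (h : Agrees ψ Q z e) (he : IsAlgebraic k e) :
    ∃ p : k[X], p ≠ 0 ∧ Agrees ψ Q (Polynomial.aeval z p) (0 : Module.End A M) := by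
  obtain ⟨p, hp, hpe⟩ := he
  exact ⟨p, hp, hpe ▸ h.aeval hQ hz p⟩

end Compatible

/-! ### Algebraicity of central fractions from the Nullstellensatz -/

section Rational

open Polynomial

variable {k : Type u} [Field k] {A : Type v} [Ring A] [Algebra k A]

/-- A central fraction with denominators outside the primitive ideal `P` satisfies a polynomial
identity modulo `P`. -/
lemma SatisfiesNullstellensatz.exists_end {F : Type*} [Ring F] [Algebra k F]
    {J P : TwoSidedIdeal A} {ψ : A →ₐ[k] F} (hA : SatisfiesNullstellensatz k A)
    (h : IsFract J ψ) (hP : IsPrimitiveIdeal P) (hJP : J ≤ P) {z : F}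
    (hz : z ∈ Subalgebra.center k F) (hd : ¬ denominators ψ hz ≤ P) :
    ∃ p : k[X], p ≠ 0 ∧ ∃ d ∉ P, ∃ b ∈ P, aeval z p * ψ d = ψ b := by
  have hprime := hP.isPrimeIdeal
  obtain ⟨M, _, _, hM, hPM⟩ := hP
  let _ : Module k M := Module.compHom M (algebraMap k A)
  have : IsScalarTower k A M := IsScalarTower.of_algebraMap_smul fun _ _ => rfl
  obtain ⟨e, he⟩ := h.exists_end hPM hJP hz hd
  have hagree : Agrees ψ P z e := by
    obtain ⟨d, hd, hdP⟩ := TwoSidedIdeal.exists_of_not_le hd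
    obtain ⟨b, hb⟩ := mem_denominators.1 hd
    exact ⟨d, hdP, b, hb, he d b hb⟩
  obtain ⟨p, hp, d, hdP, b, hb, hb0⟩ :=
    hagree.exists_polynomial hprime hz ((hA.2 M hM).isAlgebraic e)
  exact ⟨p, hp, d, hdP, b, (hPM b).2 fun m => (hb0 m).symm, hb⟩

/-- Primitive ideals are rational. -/
lemma IsPrimitiveIdeal.isRationalPrime (hnoeth : IsTwoSidedNoetherian A)
    (hA : SatisfiesNullstellensatz k A) {P : TwoSidedIdeal A} (hP : IsPrimitiveIdeal P) :
    IsRationalPrime k P := by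
  have hprime := hP.isPrimeIdeal
  obtain ⟨inst⟩ := hprime.nonempty_oreSet hnoeth
  refine ⟨hprime, inst, ⟨fun ⟨z, hz⟩ => ?_⟩⟩
  have h : IsFract P (toFract k P) := isFract_toFract hnoeth hprime
  obtain ⟨p, hp, d, hd, b, hb, hpd⟩ := hA.exists_end h hP le_rfl hz
    (h.denominators_not_le hprime hz)
  refine ⟨p, hp, ?_⟩
  rw [← ZeroMemClass.coe_eq_zero, ← aeval_center]
  refine h.eq_zero_of_mul_eq_zero hprime ?_ hd (hpd.trans ((h.map_eq_zero_iff b).2 hb))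
  rw [aeval_center hz]
  exact SetLike.coe_mem _

end Rational

/-! ## Prime ideals of graded rings -/

section Graded

open DirectSum

variable {A : Type v} [Ring A] {G σ : Type*} [AddCommGroup G] [DecidableEq G] [SetLike σ A]
  [AddSubgroupClass σ A] (𝒜 : G → σ) [GradedRing 𝒜]

lemma proj_of_mem {a : A} {i : G} (ha : a ∈ 𝒜 i) (j : G) :
    GradedRing.proj 𝒜 j a = if j = i then a else 0 := by
  rw [GradedRing.proj_apply]
  split_ifs with h
  · rw [h, decompose_of_mem_same 𝒜 ha]
  · exact decompose_of_mem_ne 𝒜 ha (Ne.symm h)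

lemma proj_mem (a : A) (i : G) : GradedRing.proj 𝒜 i a ∈ 𝒜 i := by
  rw [GradedRing.proj_apply]
  exact SetLike.coe_mem _

lemma proj_mul_left {a : A} {i : G} (ha : a ∈ 𝒜 i) (b : A) (n : G) :
    GradedRing.proj 𝒜 n (a * b) = a * GradedRing.proj 𝒜 (n - i) b := by
  rw [GradedRing.proj_apply, GradedRing.proj_apply,
    ← coe_decompose_mul_add_of_left_mem 𝒜 ha, add_sub_cancel]

lemma proj_mul_right {b : A} {i : G} (hb : b ∈ 𝒜 i) (a : A) (n : G) :
    GradedRing.proj 𝒜 n (a * b) = GradedRing.proj 𝒜 (n - i) a * b := by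
  rw [GradedRing.proj_apply, GradedRing.proj_apply,
    ← coe_decompose_mul_add_of_right_mem 𝒜 hb, sub_add_cancel]

/-- The degrees of the nonzero homogeneous components of an element. -/
def gradedSupport (a : A) : Finset G := by
  classical exact (decompose 𝒜 a).support

lemma mem_gradedSupport {a : A} {i : G} : i ∈ gradedSupport 𝒜 a ↔ GradedRing.proj 𝒜 i a ≠ 0 := by
  classical
  rw [gradedSupport, ← GradedRing.mem_support_iff]

lemma sum_proj {a : A} {S : Finset G} (hS : gradedSupport 𝒜 a ⊆ S) :
    ∑ i ∈ S, GradedRing.proj 𝒜 i a = a := by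
  classical
  rw [← Finset.sum_subset hS fun i _ hi => by_contra fun h => hi ((mem_gradedSupport 𝒜).2 h)]
  exact sum_support_decompose 𝒜 a

lemma gradedSupport_subset {a : A} {S : Finset G}
    (h : ∀ i, i ∉ S → GradedRing.proj 𝒜 i a = 0) : gradedSupport 𝒜 a ⊆ S := fun i hi =>
  by_contra fun hiS => (mem_gradedSupport 𝒜).1 hi (h i hiS)

lemma mem_of_proj_mem {I : TwoSidedIdeal A} {a : A} (h : ∀ i, GradedRing.proj 𝒜 i a ∈ I) :
    a ∈ I := by
  rw [← sum_proj 𝒜 (a := a) subset_rfl]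
  exact I.finsetSum_mem _ _ fun i _ => h i

variable {𝒜}

/-- It suffices to test primeness on homogeneous middle factors. -/
lemma IsPrimeIdeal.mem_or_mem_of_homogeneous {P : TwoSidedIdeal A} (hP : IsPrimeIdeal P) {a b : A}
    (h : ∀ i, ∀ x ∈ 𝒜 i, a * x * b ∈ P) : a ∈ P ∨ b ∈ P := by
  refine hP.mem_or_mem fun x => ?_
  rw [← sum_proj 𝒜 (a := x) subset_rfl, Finset.mul_sum, Finset.sum_mul]
  exact P.finsetSum_mem _ _ fun i _ => h i _ (proj_mem 𝒜 x i)

/-- A homogeneous ideal that is prime on homogeneous elements is prime. -/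
lemma isPrimeIdeal_of_homogeneous [UniqueSums G] {J : TwoSidedIdeal A} (h1 : (1 : A) ∉ J)
    (hJ : ∀ a ∈ J, ∀ i, GradedRing.proj 𝒜 i a ∈ J)
    (h : ∀ i j, ∀ a ∈ 𝒜 i, ∀ b ∈ 𝒜 j, (∀ x, a * x * b ∈ J) → a ∈ J ∨ b ∈ J) :
    IsPrimeIdeal J := by
  classical
  refine isPrimeIdeal_of_mem_or_mem h1 fun a b hab => ?_
  by_contra! hne
  let S : A → Finset G := fun a => (gradedSupport 𝒜 a).filter fun i => GradedRing.proj 𝒜 i a ∉ J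
  have hS : ∀ a i, i ∈ S a ↔ GradedRing.proj 𝒜 i a ∉ J := fun a i => by
    rw [Finset.mem_filter, mem_gradedSupport, and_iff_right_iff_imp]
    exact fun hi h0 => hi (h0 ▸ J.zero_mem)
  have hSne : ∀ a ∉ J, (S a).Nonempty := fun a ha => by
    by_contra hempty
    refine ha (mem_of_proj_mem 𝒜 fun i => ?_)
    by_contra hi
    exact hempty ⟨i, (hS a i).2 hi⟩
  -- Among the degrees where the components of `a` and `b` are not in `J`, the sum `g + g'` is
  -- attained only once. Hence for `y` homogeneous of degree `i`, the component of `a y b` in degree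
  -- `g + i + g'` is `a_g y b_{g'}` modulo `J`.
  obtain ⟨g, hg, g', hg', huniq⟩ :=
    UniqueSums.uniqueAdd_of_nonempty (hSne a hne.1) (hSne b hne.2)
  rw [hS] at hg hg'
  refine (h g g' _ (proj_mem 𝒜 a g) _ (proj_mem 𝒜 b g') fun x => ?_).elim hg hg'
  refine Set.mem_of_eq_of_mem (congrArg (fun y => _ * y * _)
    (sum_proj 𝒜 (a := x) subset_rfl).symm) ?_
  rw [Finset.mul_sum, Finset.sum_mul]
  refine J.finsetSum_mem _ _ fun i _ => ?_
  set y := GradedRing.proj 𝒜 i x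
  have hy : y ∈ 𝒜 i := proj_mem 𝒜 x i
  have h2 := hJ _ (hab y) (g + i + g')
  have hterm : ∀ l, GradedRing.proj 𝒜 (g + i + g') (GradedRing.proj 𝒜 l a * y * b) =
      GradedRing.proj 𝒜 l a * y * GradedRing.proj 𝒜 (g + g' - l) b := fun l => by
    rw [mul_assoc, proj_mul_left 𝒜 (proj_mem 𝒜 a l), proj_mul_left 𝒜 hy, ← mul_assoc]
    congr 3
    abel
  rw [← sum_proj 𝒜 (a := a) (Finset.subset_insert g _), Finset.sum_mul, Finset.sum_mul, map_sum,
    Finset.sum_congr rfl fun l _ => hterm l,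
    ← Finset.add_sum_erase _ _ (Finset.mem_insert_self g _), add_sub_cancel_left] at h2
  rw [← add_sub_cancel_right (_ * y * GradedRing.proj 𝒜 g' b) (Finset.sum _ _)]
  refine J.sub_mem h2 (J.finsetSum_mem _ _ fun l hl => ?_)
  by_contra hJl
  have hl1 : l ∈ S a := (hS a l).2 fun h => hJl (J.mul_mem_right _ _ (J.mul_mem_right _ _ h))
  have hl2 : g + g' - l ∈ S b := (hS b _).2 fun h => hJl (J.mul_mem_left _ _ h)
  exact (Finset.mem_erase.1 hl).1 (huniq hl1 hl2 (by abel)).1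

variable {P Q J : TwoSidedIdeal A}

/-- If `u` is an element of `Q` outside the prime `P` with the fewest homogeneous components, then
an element of `Q` with fewer components, in degrees that are a translate of degrees of `u`, has all
its components in `P`. -/
lemma proj_mem_of_card_lt (hP : IsPrimeIdeal P) {u : A} (hu : u ∈ Q) (huP : u ∉ P)
    (hmin : ∀ v ∈ Q, (gradedSupport 𝒜 v).card < (gradedSupport 𝒜 u).card → v ∈ P)
    {v : A} (hv : v ∈ Q) (hcard : (gradedSupport 𝒜 v).card < (gradedSupport 𝒜 u).card) (d : G)
    (hd : ∀ i ∈ gradedSupport 𝒜 v, i - d ∈ gradedSupport 𝒜 u) (g : G) :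
    GradedRing.proj 𝒜 g v ∈ P := by
  classical
  by_contra hg
  have hgv : g ∈ gradedSupport 𝒜 v :=
    (mem_gradedSupport 𝒜).2 fun h => hg (h ▸ P.zero_mem)
  refine huP ((hP.mem_or_mem_of_homogeneous (𝒜 := 𝒜) fun i a ha => ?_).resolve_right hg)
  have hav : a * v ∈ P := by
    refine hmin _ (Q.mul_mem_left _ _ hv) (lt_of_le_of_lt ?_ hcard)
    refine (Finset.card_le_card (t := (gradedSupport 𝒜 v).image (· + i))
      (gradedSupport_subset 𝒜 fun j hj => ?_)).trans Finset.card_image_le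
    rw [proj_mul_left 𝒜 ha]
    by_contra h0
    exact hj (Finset.mem_image.2 ⟨j - i, (mem_gradedSupport 𝒜).2 (right_ne_zero_of_mul h0),
      sub_add_cancel _ _⟩)
  -- The components in degree `(g - d) + i + g` cancel, and all others lie in a translate of the
  -- support of `u`. So this element has fewer components than `u`.
  have hw : u * a * GradedRing.proj 𝒜 g v - GradedRing.proj 𝒜 (g - d) u * (a * v) ∈ P := by
    refine hmin _ (Q.sub_mem (Q.mul_mem_right _ _ (Q.mul_mem_right _ _ hu))
      (Q.mul_mem_left _ _ (Q.mul_mem_left _ _ hv))) ?_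
    refine lt_of_le_of_lt ((Finset.card_le_card
      (t := ((gradedSupport 𝒜 u).erase (g - d)).image (· + (i + g)))
      (gradedSupport_subset 𝒜 fun j hj => ?_)).trans Finset.card_image_le)
      (Finset.card_erase_lt_of_mem (hd g hgv))
    rw [map_sub, proj_mul_right 𝒜 (proj_mem 𝒜 v g), proj_mul_right 𝒜 ha,
      proj_mul_left 𝒜 (proj_mem 𝒜 u _), proj_mul_left 𝒜 ha]
    by_cases hj' : j = g - d + (i + g)
    · have e1 : j - g - i = g - d := by rw [hj']; abel
      have e2 : j - (g - d) - i = g := by rw [hj']; abel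
      rw [e1, e2, mul_assoc, sub_self]
    · have hns : j - g - i ∉ gradedSupport 𝒜 u := fun hs => by
        refine hj (Finset.mem_image.2 ⟨_, Finset.mem_erase.2 ⟨fun h => hj' ?_, hs⟩, by abel⟩)
        rw [← h]
        abel
      have e1 : GradedRing.proj 𝒜 (j - g - i) u = 0 :=
        by_contra fun h => hns ((mem_gradedSupport 𝒜).2 h)
      have e2 : GradedRing.proj 𝒜 (j - (g - d) - i) v = 0 := by
        by_contra h
        have h3 := hd _ ((mem_gradedSupport 𝒜).2 h)
        exact hns ((by abel : j - (g - d) - i - d = j - g - i) ▸ h3)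
      rw [e1, e2, zero_mul, zero_mul, mul_zero, mul_zero, sub_zero]
  rw [← sub_add_cancel (u * a * _) (GradedRing.proj 𝒜 (g - d) u * (a * v))]
  exact P.add_mem hw (P.mul_mem_left _ _ hav)

variable (𝒜) in
/-- The families `y` for which each translate of the diagonal has its sum in `Q`. -/
def diagonalFamilies (Q : TwoSidedIdeal A) (s : Finset G) : AddSubgroup (G → A) where
  carrier := {y | ∀ d, ∑ g ∈ s, GradedRing.proj 𝒜 (d + g) (y g) ∈ Q}
  add_mem' hy hy' d := by
    simp only [Pi.add_apply, map_add, Finset.sum_add_distrib]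
    exact Q.add_mem (hy d) (hy' d)
  zero_mem' d := by simp [Q.zero_mem]
  neg_mem' hy d := by
    simp only [Pi.neg_apply, map_neg, Finset.sum_neg_distrib]
    exact Q.neg_mem (hy d)

/-- A homogeneous factor of degree `i` moves the diagonal `d` to `d - i`; this is why the condition
is imposed for every `d`. -/
lemma diagonalFamilies_mul_left {s : Finset G} {y : G → A} (hy : y ∈ diagonalFamilies 𝒜 Q s)
    (a : A) : (fun g => a * y g) ∈ diagonalFamilies 𝒜 Q s := by
  induction a using DirectSum.Decomposition.inductionOn 𝒜 with
  | zero =>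
    simp only [zero_mul]
    exact (diagonalFamilies 𝒜 Q s).zero_mem
  | @homogeneous i a =>
    intro d
    simp only [proj_mul_left 𝒜 a.2, ← Finset.mul_sum, add_sub_right_comm d]
    exact Q.mul_mem_left _ _ (hy _)
  | add a a' h h' =>
    simp only [add_mul]
    exact (diagonalFamilies 𝒜 Q s).add_mem h h'

lemma diagonalFamilies_mul_right {s : Finset G} {y : G → A} (hy : y ∈ diagonalFamilies 𝒜 Q s)
    (a : A) : (fun g => y g * a) ∈ diagonalFamilies 𝒜 Q s := by
  induction a using DirectSum.Decomposition.inductionOn 𝒜 with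
  | zero =>
    simp only [mul_zero]
    exact (diagonalFamilies 𝒜 Q s).zero_mem
  | @homogeneous i a =>
    intro d
    simp only [proj_mul_right 𝒜 a.2, ← Finset.sum_mul, add_sub_right_comm d]
    exact Q.mul_mem_right _ _ (hy _)
  | add a a' h h' =>
    simp only [mul_add]
    exact (diagonalFamilies 𝒜 Q s).add_mem h h'

lemma sum_mem_of_mem_diagonalFamilies {s : Finset G} {y : G → A}
    (hy : y ∈ diagonalFamilies 𝒜 Q s) : ∑ g ∈ s, y g ∈ Q := by
  classical
  let D : Finset G := s.biUnion fun g => (gradedSupport 𝒜 (y g)).image (· - g)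
  have h : ∀ g ∈ s, y g = ∑ d ∈ D, GradedRing.proj 𝒜 (d + g) (y g) := fun g hg => by
    rw [← Finset.sum_image (f := fun i => GradedRing.proj 𝒜 i (y g)) (g := fun d => d + g)
      (fun d _ d' _ hdd => add_right_cancel hdd), sum_proj]
    intro i hi
    exact Finset.mem_image.2 ⟨i - g, Finset.mem_biUnion.2 ⟨g, hg, Finset.mem_image_of_mem _ hi⟩,
      sub_add_cancel _ _⟩
  rw [Finset.sum_congr rfl h, Finset.sum_comm]
  exact Q.finsetSum_mem _ _ fun d _ => hy d

lemma proj_mem_diagonalFamilies {u : A} (hu : u ∈ Q) :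
    (fun g => GradedRing.proj 𝒜 g u) ∈ diagonalFamilies 𝒜 Q (gradedSupport 𝒜 u) := by
  intro d
  simp only [proj_of_mem 𝒜 (proj_mem 𝒜 u _), add_eq_right]
  split_ifs
  · rwa [sum_proj 𝒜 subset_rfl]
  · simp [Q.zero_mem]

/-- If `J ≤ Q` is homogeneous and contains the homogeneous elements of the prime `P`, and `Q` is
not contained in `P`, then some `u ∈ Q` outside `P` is such that the homogeneous components of
`u`, as a family, are multiples of one component `g₀` by partial endomorphisms of `A / J`. -/
lemma exists_minimal_element (hP : IsPrimeIdeal P) (hJP : J ≤ P) (hJQ : J ≤ Q)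
    (hJ : ∀ a ∈ J, ∀ i, GradedRing.proj 𝒜 i a ∈ J) (hPJ : ∀ i, ∀ a ∈ 𝒜 i, a ∈ P → a ∈ J)
    (hQP : ¬ Q ≤ P) :
    ∃ u ∈ Q, u ∉ P ∧ ∃ g₀, GradedRing.proj 𝒜 g₀ u ∉ J ∧
      ∀ y ∈ diagonalFamilies 𝒜 Q (gradedSupport 𝒜 u), y g₀ ∈ J →
        ∀ g ∈ gradedSupport 𝒜 u, y g ∈ J := by
  classical
  obtain ⟨u, ⟨hu, huP⟩, hmin'⟩ := exists_minimalFor_of_wellFoundedLT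
    (fun a : A => a ∈ Q ∧ a ∉ P) (fun a => (gradedSupport 𝒜 a).card)
    (TwoSidedIdeal.exists_of_not_le hQP)
  have hmin : ∀ v ∈ Q, (gradedSupport 𝒜 v).card < (gradedSupport 𝒜 u).card → v ∈ P :=
    fun v hv hlt => by_contra fun hvP => (hmin' ⟨hv, hvP⟩ hlt.le).not_gt hlt
  obtain ⟨g₀, hg₀⟩ : ∃ g₀, GradedRing.proj 𝒜 g₀ u ∉ J := by
    by_contra! h
    exact huP (hJP (mem_of_proj_mem 𝒜 h))
  have hg₀u : g₀ ∈ gradedSupport 𝒜 u := (mem_gradedSupport 𝒜).2 fun h => hg₀ (h ▸ J.zero_mem)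
  refine ⟨u, hu, huP, g₀, hg₀, fun y hy hyJ g hg => mem_of_proj_mem 𝒜 fun t => ?_⟩
  rcases eq_or_ne g g₀ with rfl | hne
  · exact hJ _ hyJ t
  have hd : t - g + g = t := sub_add_cancel t g
  generalize t - g = d at hd
  subst hd
  -- The part of the diagonal `d` outside `g₀`. It stays in `Q` because the removed term lies in `J
  -- ≤ Q`, and its support lies in a translate of that of `u` with one degree missing.
  let v := ∑ i ∈ (gradedSupport 𝒜 u).erase g₀, GradedRing.proj 𝒜 (d + i) (y i)
  have hvQ : v ∈ Q := by
    have h1 := hy d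
    rw [← Finset.add_sum_erase _ _ hg₀u] at h1
    have h2 := Q.sub_mem h1 (hJQ (hJ _ hyJ (d + g₀)))
    rwa [add_sub_cancel_left] at h2
  have hproj : ∀ j, GradedRing.proj 𝒜 j v =
      if j - d ∈ (gradedSupport 𝒜 u).erase g₀ then GradedRing.proj 𝒜 j (y (j - d)) else 0 := by
    intro j
    simp only [v, map_sum, proj_of_mem 𝒜 (proj_mem 𝒜 (y _) _)]
    rw [← Finset.sum_ite_eq' ((gradedSupport 𝒜 u).erase g₀) (j - d)
      fun i => GradedRing.proj 𝒜 j (y i)]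
    refine Finset.sum_congr rfl fun i _ => ?_
    by_cases h : j = d + i
    · rw [if_pos h, if_pos (by rw [h]; abel), h]
    · rw [if_neg h, if_neg fun h' => h (by rw [h']; abel)]
  have hsupp : ∀ j ∈ gradedSupport 𝒜 v, j - d ∈ (gradedSupport 𝒜 u).erase g₀ := fun j hj => by
    by_contra h
    rw [mem_gradedSupport, hproj, if_neg h] at hj
    exact hj rfl
  have hcard : (gradedSupport 𝒜 v).card < (gradedSupport 𝒜 u).card := by
    refine lt_of_le_of_lt (Finset.card_le_card_of_injOn (· - d) hsupp ?_)
      (Finset.card_erase_lt_of_mem hg₀u)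
    exact fun a _ b _ h => sub_left_injective h
  have := proj_mem_of_card_lt hP hu huP hmin hvQ hcard d
    (fun i hi => Finset.mem_of_mem_erase (hsupp i hi)) (d + g)
  rw [hproj, add_sub_cancel_left, if_pos (Finset.mem_erase.2 ⟨hne, hg⟩)] at this
  exact hPJ _ _ (proj_mem 𝒜 _ _) this

end Graded

/-! ## The grading given by a rational torus action -/

section Weights

variable {k : Type u} [Field k] {r : ℕ}

/-- The character of the torus with given exponents. -/
def torusChar (g : Fin r → ℤ) : Torus k r →* kˣ where
  toFun h := ∏ i, h i ^ g i
  map_one' := by simp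
  map_mul' h h' := by simp [mul_zpow, Finset.prod_mul_distrib]

lemma torusChar_apply (g : Fin r → ℤ) (h : Torus k r) : torusChar g h = ∏ i, h i ^ g i := rfl

lemma torusChar_zero (h : Torus k r) : torusChar 0 h = 1 := by simp [torusChar_apply]

lemma torusChar_add (g g' : Fin r → ℤ) (h : Torus k r) :
    torusChar (g + g') h = torusChar g h * torusChar g' h := by
  simp [torusChar_apply, zpow_add, Finset.prod_mul_distrib]

lemma torusChar_neg (g : Fin r → ℤ) (h : Torus k r) :
    torusChar (-g) h = (torusChar g h)⁻¹ := by
  simp [torusChar_apply]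

lemma exists_unit_zpow_ne_one [Infinite k] {n : ℤ} (hn : n ≠ 0) : ∃ x : kˣ, x ^ n ≠ 1 := by
  by_contra! h
  have hpos : 0 < n.natAbs := Int.natAbs_pos.2 hn
  have hroot : ∀ x : kˣ, x ^ n.natAbs = 1 := fun x => by
    rcases Int.natAbs_eq n with h' | h'
    · rw [← zpow_natCast, ← h']
      exact h x
    · rw [← zpow_natCast, ← inv_inj, ← zpow_neg, ← h', h x, inv_one]
  classical
  refine Set.infinite_univ (α := k)
    (((Polynomial.nthRoots n.natAbs (1 : k)).toFinset.finite_toSet.insert 0).subset fun x _ => ?_)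
  rcases eq_or_ne x 0 with rfl | hx
  · exact Set.mem_insert _ _
  · refine Set.mem_insert_of_mem _ ?_
    rw [Finset.mem_coe, Multiset.mem_toFinset, Polynomial.mem_nthRoots hpos]
    exact congrArg Units.val (hroot (Units.mk0 x hx))

lemma torusChar_injective [Infinite k] :
    Function.Injective (torusChar : (Fin r → ℤ) → (Torus k r →* kˣ)) := by
  intro g g' h
  by_contra hne
  obtain ⟨i, hi⟩ := Function.ne_iff.1 hne
  obtain ⟨x, hx⟩ := exists_unit_zpow_ne_one (k := k) (sub_ne_zero.2 hi)
  have key : ∀ f : Fin r → ℤ, torusChar f (Pi.mulSingle i x : Torus k r) = x ^ f i := fun f => by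
    rw [torusChar_apply, Finset.prod_eq_single i (fun j _ hj => by
      rw [Pi.mulSingle_eq_of_ne hj, one_zpow]) (fun h => (h (Finset.mem_univ _)).elim),
      Pi.mulSingle_eq_same]
  refine hx ?_
  rw [zpow_sub, ← key g, ← key g', h, mul_inv_cancel]

lemma linearIndependent_torusChar [Infinite k] :
    LinearIndependent k fun (g : Fin r → ℤ) (h : Torus k r) => (torusChar g h : k) := by
  let c : (Fin r → ℤ) → (Torus k r →* k) := fun g => (Units.coeHom k).comp (torusChar g)
  have hinj : Function.Injective c := fun g g' h =>
    torusChar_injective (k := k) (MonoidHom.ext fun x => Units.ext (DFunLike.congr_fun h x))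
  exact (linearIndependent_monoidHom (Torus k r) k).comp c hinj

/-- A submodule that contains all the combinations `∑ χ_g(h) v_g` contains all the `v_g`. -/
lemma mem_of_forall_sum_torusChar_smul_mem [Infinite k] {V : Type*} [AddCommGroup V] [Module k V]
    (W : Submodule k V) (S : Finset (Fin r → ℤ)) (v : (Fin r → ℤ) → V)
    (h : ∀ t : Torus k r, ∑ g ∈ S, (torusChar g t : k) • v g ∈ W) : ∀ g ∈ S, v g ∈ W := by
  intro g hg
  rw [← Submodule.Quotient.mk_eq_zero, ← Module.forall_dual_apply_eq_zero_iff k]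
  intro φ
  refine linearIndependent_iff'.1 (linearIndependent_torusChar (k := k) (r := r)) S
    (fun g => φ (Submodule.Quotient.mk (v g))) ?_ g hg
  ext t
  have h1 := congrArg φ ((Submodule.Quotient.mk_eq_zero W).2 (h t))
  rw [← Submodule.mkQ_apply, map_sum, map_sum, map_zero] at h1
  simp only [map_smul, smul_eq_mul, Submodule.mkQ_apply] at h1
  simpa [Finset.sum_apply, mul_comm] using h1

/-- The functions with values in `V` that are sums of characters with coefficients in `V`. -/
def charFunctions (k : Type u) [Field k] (r : ℕ) (V : Type*) [AddCommGroup V] [Module k V] :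
    Submodule k (Torus k r → V) :=
  LinearMap.range (Finsupp.lsum k (fun g : Fin r → ℤ =>
    (LinearMap.pi fun h : Torus k r => (torusChar g h : k) • LinearMap.id : V →ₗ[k] Torus k r → V)))

lemma mem_charFunctions {V : Type*} [AddCommGroup V] [Module k V] {f : Torus k r → V} :
    f ∈ charFunctions k r V ↔
      ∃ v : (Fin r → ℤ) →₀ V, ∀ h, f h = ∑ g ∈ v.support, (torusChar g h : k) • v g := by
  rw [charFunctions, LinearMap.mem_range]
  refine exists_congr fun v => ⟨fun h t => ?_, fun h => funext fun t => ?_⟩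
  · rw [← h, Finsupp.lsum_apply, Finsupp.sum, Finset.sum_apply]
    rfl
  · rw [h, Finsupp.lsum_apply, Finsupp.sum, Finset.sum_apply]
    rfl

lemma torusChar_smul_mem_charFunctions {V : Type*} [AddCommGroup V] [Module k V]
    (g : Fin r → ℤ) (v : V) :
    (fun h : Torus k r => (torusChar g h : k) • v) ∈ charFunctions k r V :=
  ⟨Finsupp.single g v, by rw [Finsupp.lsum_single]; rfl⟩

lemma IsRegularFunction.smul_mem_charFunctions {V : Type*} [AddCommGroup V] [Module k V]
    {f : Torus k r → k} (hf : IsRegularFunction f) (v : V) :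
    (fun h => f h • v) ∈ charFunctions k r V := by
  obtain ⟨p, hp⟩ := hf
  -- The second block of variables is evaluated at inverses, so a monomial is the character whose
  -- exponents are the differences of the two blocks.
  have : (fun h => f h • v) = ∑ d ∈ p.support, p.coeff d • fun h : Torus k r =>
      (torusChar (fun i => (d (Sum.inl i) : ℤ) - d (Sum.inr i)) h : k) • v := by
    ext h
    rw [hp, MvPolynomial.eval_eq', Finset.sum_smul, Finset.sum_apply]
    refine Finset.sum_congr rfl fun d _ => ?_
    rw [Pi.smul_apply, mul_smul, Fintype.prod_sum_type, ← Finset.prod_mul_distrib,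
      torusChar_apply, Units.coe_prod]
    congr 2
    refine Finset.prod_congr rfl fun i _ => ?_
    simp [zpow_sub]
  rw [this]
  exact Submodule.sum_mem _ fun d _ =>
    Submodule.smul_mem _ _ (torusChar_smul_mem_charFunctions _ _)

variable {A : Type v} [Ring A] [Algebra k A] (ρ : Torus k r →* (A ≃ₐ[k] A))

/-- The weight spaces of a torus action. -/
def weightSpace (g : Fin r → ℤ) : Submodule k A where
  carrier := {a | ∀ h, ρ h a = (torusChar g h : k) • a}
  add_mem' ha hb h := by rw [map_add, ha h, hb h, smul_add]
  zero_mem' h := by simp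
  smul_mem' c a ha h := by rw [map_smul, ha h, smul_comm]

variable {ρ}

variable (ρ) in
lemma weightSpace_gradedMonoid : SetLike.GradedMonoid (weightSpace ρ) where
  one_mem h := by simp [torusChar_zero]
  mul_mem g g' a b ha hb h := by
    rw [map_mul, ha h, hb h, torusChar_add, Units.val_mul, smul_mul_smul_comm]

/-- A rational action is diagonalizable. -/
lemma IsRationalAction.exists_sum_weights [Infinite k] (hρ : IsRationalAction ρ) (a : A) :
    ∃ v : (Fin r → ℤ) →₀ A, (∀ g, v g ∈ weightSpace ρ g) ∧ a = ∑ g ∈ v.support, v g := by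
  obtain ⟨S, -, hcov, hS⟩ := hρ
  obtain ⟨V, hVS, haV⟩ := hcov a
  obtain ⟨hfd, hV, hreg⟩ := hS V hVS
  let B := Module.finBasis k V
  have hmem : (fun h => ρ h a) ∈ charFunctions k r A := by
    have : (fun h => ρ h a) =
        ∑ i, fun h => B.coord i ⟨ρ h a, hV h a haV⟩ • (B i : A) := by
      ext h
      rw [Finset.sum_apply]
      have h1 := congrArg (Subtype.val) (B.sum_repr ⟨ρ h a, hV h a haV⟩)
      rw [Submodule.coe_sum] at h1
      exact h1.symm
    rw [this]
    exact Submodule.sum_mem _ fun i _ => (hreg ⟨a, haV⟩ (B.coord i)).smul_mem_charFunctions _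
  obtain ⟨v, hv⟩ := mem_charFunctions.1 hmem
  refine ⟨v, fun g h => ?_, ?_⟩
  · by_cases hg : g ∈ v.support
    · rw [← sub_eq_zero, ← Submodule.mem_bot k]
      -- Expanding `ρ (h t) a` in characters of `t` in two ways and comparing coefficients shows
      -- that `v g` has weight `g`.
      refine mem_of_forall_sum_torusChar_smul_mem ⊥ v.support
        (fun g => ρ h (v g) - (torusChar g h : k) • v g) (fun t => ?_) g hg
      have h1 : ρ (h * t) a = ρ h (ρ t a) := by rw [map_mul]; rfl
      rw [hv, hv t, map_sum] at h1
      simp only [Submodule.mem_bot, smul_sub, Finset.sum_sub_distrib, sub_eq_zero]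
      rw [Finset.sum_congr rfl fun g _ => (map_smul (ρ h) (torusChar g t : k) (v g)).symm, ← h1]
      refine Finset.sum_congr rfl fun g _ => ?_
      rw [map_mul, mul_comm, Units.val_mul, mul_smul]
    · rw [Finsupp.notMem_support_iff.1 hg]
      simp
  · have := hv 1
    simpa using this

variable (ρ) in
lemma weightSpace_isInternal [Infinite k] (hρ : IsRationalAction ρ) :
    DirectSum.IsInternal (weightSpace ρ) := by
  classical
  refine ⟨(injective_iff_map_eq_zero _).2 fun x hx => ?_, fun a => ?_⟩
  · ext g
    by_cases hg : g ∈ x.support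
    · change (x g : A) = 0
      rw [← Submodule.mem_bot k]
      refine mem_of_forall_sum_torusChar_smul_mem ⊥ x.support (fun g => (x g : A))
        (fun t => ?_) g hg
      rw [DirectSum.coeAddMonoidHom_eq_dfinsuppSum, DFinsupp.sum] at hx
      have h1 := congrArg (ρ t) hx
      rw [map_sum, map_zero] at h1
      rw [Submodule.mem_bot, ← h1]
      exact Finset.sum_congr rfl fun g _ => ((x g).2 t).symm
    · rw [DFinsupp.notMem_support_iff.1 hg]
      rfl
  · obtain ⟨v, hv, rfl⟩ := hρ.exists_sum_weights a
    refine ⟨∑ g ∈ v.support, DirectSum.of (fun g => weightSpace ρ g) g ⟨v g, hv g⟩, ?_⟩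
    rw [map_sum]
    exact Finset.sum_congr rfl fun g _ => DirectSum.coeAddMonoidHom_of _ _ _

/-- The grading of `A` given by a rational torus action. -/
@[reducible]
def weightGrading [Infinite k] (hρ : IsRationalAction ρ) : GradedRing (weightSpace ρ) where
  __ := weightSpace_gradedMonoid ρ
  __ := (weightSpace_isInternal ρ hρ).chooseDecomposition

end Weights

/-! ## Stable ideals -/

section Stable

variable {k : Type u} [Field k] {A : Type v} [Ring A] [Algebra k A] {H : Type*} [Group H]
  {ρ : H →* (A ≃ₐ[k] A)}

lemma action_inv_apply (h : H) (a : A) : ρ h (ρ h⁻¹ a) = a := by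
  rw [← AlgEquiv.mul_apply, ← map_mul, mul_inv_cancel, map_one, AlgEquiv.one_apply]

lemma action_mul_apply (h h' : H) (a : A) : ρ (h * h') a = ρ h (ρ h' a) := by
  rw [map_mul, AlgEquiv.mul_apply]

lemma mem_translate {h : H} {I : TwoSidedIdeal A} {a : A} :
    a ∈ translate ρ h I ↔ ρ h⁻¹ a ∈ I := by
  rw [translate, RingEquiv.mapTwoSidedIdeal_apply, TwoSidedIdeal.mem_comap, map_inv]
  rfl

lemma mem_core {I : TwoSidedIdeal A} {a : A} : a ∈ core ρ I ↔ ∀ h, ρ h a ∈ I := by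
  rw [core, TwoSidedIdeal.mem_iInf]
  simp only [mem_translate]
  exact ⟨fun h x => by simpa using h x⁻¹, fun h x => h _⟩

lemma core_le (I : TwoSidedIdeal A) : core ρ I ≤ I := fun a ha => by
  simpa using mem_core.1 ha 1

lemma isStable_core (I : TwoSidedIdeal A) : IsStable ρ (core ρ I) := fun h a ha =>
  mem_core.2 fun h' => by rw [← action_mul_apply]; exact mem_core.1 ha _

lemma IsStable.le_core {I P : TwoSidedIdeal A} (hI : IsStable ρ I) (h : I ≤ P) : I ≤ core ρ P :=
  fun a ha => mem_core.2 fun t => h (hI t a ha)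

/-- The core of a prime ideal is `H`-prime. -/
lemma IsPrimeIdeal.isHPrime_core {P : TwoSidedIdeal A} (hP : IsPrimeIdeal P) :
    IsHPrime ρ (core ρ P) := by
  refine ⟨fun h => hP.one_notMem (core_le (ρ := ρ) P (h ▸ TwoSidedIdeal.mem_top A)),
    isStable_core P, fun I I' hI hI' hII' => ?_⟩
  exact (hP.2 I I' fun a ha b hb => core_le P (hII' a ha b hb)).imp hI.le_core hI'.le_core

lemma core_translate (h : H) (P : TwoSidedIdeal A) : core ρ (translate ρ h P) = core ρ P := by
  ext a
  simp only [mem_core, mem_translate, ← action_mul_apply]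
  exact ⟨fun ha t => by simpa using ha (h * t), fun ha t => ha _⟩

lemma IsPrimitiveIdeal.translate {P : TwoSidedIdeal A} (hP : IsPrimitiveIdeal P) (h : H) :
    IsPrimitiveIdeal (translate ρ h P) :=
  isPrimitiveIdeal_of_surjective (f := (ρ h⁻¹ : A ≃+* A).toRingHom) (ρ h⁻¹).surjective hP
    fun _ => mem_translate

lemma translate_mem_primStratum {J P : TwoSidedIdeal A} (hP : P ∈ primStratum ρ J) (h : H) :
    translate ρ h P ∈ primStratum ρ J :=
  ⟨IsPrimitiveIdeal.translate hP.1 h, (IsPrimitiveIdeal.translate hP.1 h).isPrimeIdeal,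
    (core_translate h P).trans hP.2.2⟩

/-- A prime that is maximal in its stratum is locally closed, if there are finitely many
`H`-primes. -/
lemma isLocallyClosedPrime_of_maximal (hfin : (HSpec ρ).Finite) {J P : TwoSidedIdeal A}
    (hP : Maximal (· ∈ specStratum ρ J) P) : IsLocallyClosedPrime P := by
  obtain ⟨⟨hprime, hcore⟩, hmax⟩ := hP
  have hprime : IsPrimeIdeal P := hprime
  refine ⟨hprime, lt_of_le_of_ne (le_sInf fun Q hQ => hQ.2.le) fun heq => ?_⟩
  -- A prime `Q ⊋ P` with `(Q : H) ≤ P` would lie in the same stratum, against maximality. So `(Q :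
  -- H)` is one of these `H`-primes, and `a ∈ Q`.
  obtain ⟨a, haP, ha⟩ := hprime.exists_mem_of_finite
    (S := {J' ∈ HSpec ρ | ¬ J' ≤ P}) (hfin.subset (Set.sep_subset _ _)) fun I hI => hI.2
  refine haP ?_
  rw [heq, TwoSidedIdeal.mem_sInf]
  rintro Q ⟨hQ, hPQ⟩
  refine core_le (ρ := ρ) Q (ha _ ⟨hQ.isHPrime_core, fun hle => ?_⟩)
  have hQJ : core ρ Q = J := by
    refine le_antisymm ?_ ?_
    · rw [← hcore]
      exact (isStable_core Q).le_core hle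
    · rw [← hcore]
      exact (isStable_core P).le_core ((core_le P).trans hPQ.le)
  exact hPQ.not_ge (hmax ⟨hQ, hQJ⟩ hPQ.le)

end Stable

/-! ### Stable ideals as homogeneous ideals, and maximality of rational primes -/

section Torus

lemma smul_mem_ideal {k : Type u} [Field k] {A : Type v} [Ring A] [Algebra k A]
    (I : TwoSidedIdeal A) (c : k) {a : A} (ha : a ∈ I) : c • a ∈ I := by
  rw [Algebra.smul_def]
  exact I.mul_mem_left _ _ ha

lemma mem_core_of_mem_weightSpace {k : Type u} [Field k] {A : Type v} [Ring A] [Algebra k A]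
    {r : ℕ} {ρ : Torus k r →* (A ≃ₐ[k] A)} {P : TwoSidedIdeal A} {g : Fin r → ℤ} {a : A}
    (ha : a ∈ weightSpace ρ g) (haP : a ∈ P) : a ∈ core ρ P :=
  mem_core.2 fun h => by
    rw [ha h]
    exact smul_mem_ideal P _ haP

variable {k : Type u} [Field k] [Infinite k] {A : Type v} [Ring A] [Algebra k A] {r : ℕ}
  {ρ : Torus k r →* (A ≃ₐ[k] A)}

/-- Stable ideals are homogeneous. -/
lemma IsStable.proj_mem (hρ : IsRationalAction ρ) {I : TwoSidedIdeal A} (hI : IsStable ρ I)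
    {a : A} (ha : a ∈ I) (g : Fin r → ℤ) :
    letI := weightGrading hρ
    GradedRing.proj (weightSpace ρ) g a ∈ I := by
  let _ := weightGrading hρ
  by_cases hg : g ∈ gradedSupport (weightSpace ρ) a
  · refine mem_of_forall_sum_torusChar_smul_mem (I.asIdeal.restrictScalars k)
      (gradedSupport (weightSpace ρ) a) (fun g => GradedRing.proj (weightSpace ρ) g a)
      (fun t => ?_) g hg
    have h1 : ρ t a ∈ I := hI t a ha
    rw [← sum_proj (weightSpace ρ) (a := a) subset_rfl, map_sum,
      Finset.sum_congr rfl fun g _ => TorusStrat.proj_mem (weightSpace ρ) a g t] at h1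
    exact h1
  · rw [mem_gradedSupport, not_not] at hg
    exact Set.mem_of_eq_of_mem hg I.zero_mem

/-- For a torus, `H`-prime ideals are prime. -/
lemma IsHPrime.isPrimeIdeal (hρ : IsRationalAction ρ) {J : TwoSidedIdeal A} (hJ : IsHPrime ρ J) :
    IsPrimeIdeal J := by
  let _ := weightGrading hρ
  refine isPrimeIdeal_of_homogeneous (𝒜 := weightSpace ρ)
    (fun h1 => hJ.1 ((TwoSidedIdeal.one_mem_iff J).1 h1))
    (fun a ha i => hJ.2.1.proj_mem hρ ha i) fun i j a ha b hb hab => ?_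
  -- For `a` a weight vector the colon ideal is stable, so the `H`-prime condition applies to it.
  have hstable : IsStable ρ (rightColon J a) := fun h d hd => mem_rightColon.2 fun x => by
    have h1 := hJ.2.1 h _ (smul_mem_ideal J (((torusChar i h)⁻¹ : kˣ) : k)
      (mem_rightColon.1 hd (ρ h⁻¹ x)))
    rw [map_smul, map_mul, map_mul, ha h, action_inv_apply, smul_mul_assoc, smul_mul_assoc,
      smul_smul, Units.inv_mul, one_smul] at h1
    exact h1
  have hstable' : IsStable ρ (leftColon J (rightColon J a)) := fun h c hc =>
    mem_leftColon.2 fun d hd => by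
      have h1 := hJ.2.1 h _ (mem_leftColon.1 hc _ (hstable h⁻¹ d hd))
      rwa [map_mul, action_inv_apply] at h1
  refine (hJ.2.2 _ _ hstable' hstable fun c hc d hd => mem_leftColon.1 hc d hd).imp
    (fun hle => hle ?_) (fun hle => hle ?_)
  · exact mem_leftColon.2 fun d hd => by simpa using mem_rightColon.1 hd 1
  · exact mem_rightColon.2 hab

/-- If there are finitely many `H`-primes, every stratum contains a primitive ideal. -/
lemma exists_mem_primStratum (hρ : IsRationalAction ρ) (hA : IsJacobson A)
    (hfin : (HSpec ρ).Finite) {J : TwoSidedIdeal A} (hJ : IsHPrime ρ J) :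
    ∃ P, P ∈ primStratum ρ J := by
  have hprime := hJ.isPrimeIdeal hρ
  obtain ⟨a, haJ, ha⟩ := hprime.exists_mem_of_finite (S := {J' ∈ HSpec ρ | ¬ J' ≤ J})
    (hfin.subset (Set.sep_subset _ _)) fun I hI => hI.2
  obtain ⟨P, hP, hJP, haP⟩ := hA.exists_isPrimitiveIdeal hprime haJ
  refine ⟨P, hP, hP.isPrimeIdeal, le_antisymm ?_ (hJ.2.1.le_core hJP)⟩
  by_contra hle
  exact haP (core_le (ρ := ρ) P (ha _ ⟨hP.isPrimeIdeal.isHPrime_core, hle⟩))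

/-- Rational primes are maximal in their strata. -/
lemma IsRationalPrime.maximal (hρ : IsRationalAction ρ) (hnoeth : IsTwoSidedNoetherian A)
    {P : TwoSidedIdeal A} (hP : IsRationalPrime k P) :
    Maximal (· ∈ specStratum ρ (core ρ P)) P := by
  obtain ⟨hprime, _, halg⟩ := hP
  refine ⟨⟨hprime, rfl⟩, fun Q hQ hPQ => ?_⟩
  by_contra hQP
  have hQprime : IsPrimeIdeal Q := hQ.1
  let _ := weightGrading hρ
  have hJQ : core ρ P ≤ Q := hQ.2 ▸ core_le Q
  obtain ⟨u, hu, huP, g₀, hg₀, hW⟩ := exists_minimal_element (𝒜 := weightSpace ρ) hprime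
    (core_le (ρ := ρ) P) hJQ (fun a ha i => (isStable_core P).proj_mem hρ ha i)
    (fun i a ha haP => mem_core_of_mem_weightSpace ha haP) hQP
  set s := gradedSupport (weightSpace ρ) u
  have hFr : IsFract P (toFract k P) := isFract_toFract hnoeth hprime
  let T : AddSubgroup (A × A) := (diagonalFamilies (weightSpace ρ) Q s).map
    { toFun := fun y => (y g₀, ∑ g ∈ s, y g)
      map_zero' := by simp
      map_add' := fun y y' => by simp [Finset.sum_add_distrib] }
  have huT : (GradedRing.proj (weightSpace ρ) g₀ u, u) ∈ T :=
    ⟨_, proj_mem_diagonalFamilies hu, Prod.ext rfl (sum_proj _ subset_rfl)⟩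
  have hTleft : ∀ (a : A), ∀ t ∈ T, (a * t.1, a * t.2) ∈ T := by
    rintro a _ ⟨y, hy, rfl⟩
    exact ⟨_, diagonalFamilies_mul_left hy a, Prod.ext rfl (Finset.mul_sum _ _ _).symm⟩
  have hTright : ∀ (a : A), ∀ t ∈ T, (t.1 * a, t.2 * a) ∈ T := by
    rintro a _ ⟨y, hy, rfl⟩
    exact ⟨_, diagonalFamilies_mul_right hy a, Prod.ext rfl (Finset.sum_mul _ _ _).symm⟩
  have hTJ : ∀ t ∈ T, t.1 ∈ core ρ P → t.2 ∈ core ρ P := by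
    rintro _ ⟨y, hy, rfl⟩ h
    exact (core ρ P).finsetSum_mem _ _ fun g hg => hW y hy h g hg
  have hTQ : ∀ t ∈ T, t.2 ∈ Q := by
    rintro _ ⟨y, hy, rfl⟩
    exact sum_mem_of_mem_diagonalFamilies hy
  have hg₀P : GradedRing.proj (weightSpace ρ) g₀ u ∉ P := fun h =>
    hg₀ (mem_core_of_mem_weightSpace (TorusStrat.proj_mem (weightSpace ρ) u g₀) h)
  -- The map is defined modulo `J`; to live on `A / P` it must preserve `P`. Comparing `t · (a
  -- u_{g₀})` with `(t.1 a) · (u_{g₀}, u)` gives `t.2 a u_{g₀} ≡ t.1 a u` modulo `J`.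
  have hTP : ∀ t ∈ T, t.1 ∈ P → t.2 ∈ P := by
    intro t ht h
    refine (hprime.mem_or_mem fun a => ?_).resolve_right hg₀P
    have h1 := hTJ _ (T.sub_mem (hTright (a * GradedRing.proj (weightSpace ρ) g₀ u) t ht)
      (hTleft (t.1 * a) _ huT)) (by
        simp only [Prod.fst_sub]
        rw [mul_assoc, sub_self]
        exact (core ρ P).zero_mem)
    have h2 := P.add_mem (core_le P h1) (P.mul_mem_right _ u (P.mul_mem_right _ a h))
    rw [Prod.snd_sub, sub_add_cancel] at h2
    rw [mul_assoc]
    exact h2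
  obtain ⟨z, hz, hzT⟩ := hFr.exists_central T hTleft hTright hTP ⟨_, huT, hg₀P⟩
  have hz0 : z ≠ 0 := by
    rintro rfl
    have := hzT _ huT
    rw [zero_mul] at this
    exact huP ((hFr.map_eq_zero_iff _).1 this.symm)
  have hzreg : z ∈ nonZeroDivisors _ := (hFr.isUnit_of_mem_center hprime hz hz0).mem_nonZeroDivisors
  have hzalg : IsAlgebraic k z := by
    obtain ⟨p, hp, hpz⟩ := halg.isAlgebraic ⟨z, hz⟩
    exact ⟨p, hp, by rw [aeval_center hz, hpz]; rfl⟩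
  -- As `z` is regular, powers of the variable can be cancelled from its polynomial, so that the
  -- constant term is nonzero.
  obtain ⟨q, hq0, hqz⟩ := hzalg.exists_nonzero_coeff_and_aeval_eq_zero hzreg
  have hagree : Agrees (toFract k P) Q z (0 : Module.End A (A ⧸ Q.asIdeal)) := by
    refine ⟨_, fun h => hg₀ ?_, u, hzT _ huT, fun m => ?_⟩
    · have h1 : core ρ Q = core ρ P := hQ.2
      exact h1 ▸ mem_core_of_mem_weightSpace (TorusStrat.proj_mem (weightSpace ρ) u g₀) h
    · obtain ⟨a, rfl⟩ := Submodule.Quotient.mk_surjective _ m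
      rw [← Submodule.Quotient.mk_smul]
      exact ((Submodule.Quotient.mk_eq_zero _).2 (Q.mul_mem_right _ _ hu)).symm
  -- Modulo `Q`, the fraction `q(z) = 0` acts as the scalar `q(0)`, which puts `q(0) d`, and hence
  -- `d`, in `Q`.
  obtain ⟨d, hdQ, b, hb, hdb⟩ := hagree.aeval hQprime hz q
  rw [hqz, zero_mul] at hb
  have h1 := hdb (Submodule.Quotient.mk 1)
  rw [← Polynomial.coeff_zero_eq_aeval_zero', Module.algebraMap_end_apply,
    ← Submodule.Quotient.mk_smul, ← Submodule.Quotient.mk_smul, ← Submodule.Quotient.mk_smul,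
    Submodule.Quotient.eq, smul_eq_mul, smul_eq_mul, mul_one, mul_one] at h1
  have h2 := Q.add_mem h1 (hPQ ((hFr.map_eq_zero_iff b).1 hb.symm))
  rw [sub_add_cancel] at h2
  have h3 := smul_mem_ideal Q (q.coeff 0)⁻¹ h2
  rw [smul_smul, inv_mul_cancel₀ hq0, one_smul] at h3
  exact hdQ h3

end Torus

/-! ## Weight vectors in the center of the ring of fractions -/

section WeightFractions

variable {k : Type u} [Field k] {A : Type v} [Ring A] [Algebra k A] {r : ℕ}
  {ρ : Torus k r →* (A ≃ₐ[k] A)} {F : Type w} [Ring F] [Algebra k F] {J : TwoSidedIdeal A}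
  {ψ : A →ₐ[k] F} {σ : Torus k r → F →ₐ[k] F}

/-- A central fraction of weight `g`. -/
structure IsWeightFraction (σ : Torus k r → F →ₐ[k] F) (g : Fin r → ℤ) (z : F) : Prop where
  mem_center : z ∈ Subalgebra.center k F
  map_eq : ∀ h, σ h z = (torusChar g h : k) • z

lemma IsWeightFraction.mul {g g' : Fin r → ℤ} {z z' : F} (hz : IsWeightFraction σ g z)
    (hz' : IsWeightFraction σ g' z') : IsWeightFraction σ (g + g') (z * z') where
  mem_center := Subalgebra.mul_mem _ hz.mem_center hz'.mem_center
  map_eq h := by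
    rw [map_mul, hz.map_eq, hz'.map_eq, torusChar_add, Units.val_mul, smul_mul_smul_comm]

lemma IsWeightFraction.inv {g : Fin r → ℤ} {u : Fˣ} (hz : IsWeightFraction σ g u) :
    IsWeightFraction σ (-g) (↑u⁻¹ : F) where
  mem_center := Subalgebra.mem_center_iff.2 fun b => by
    rw [← Units.mul_left_inj u, Units.inv_mul_cancel_right, mul_assoc,
      mul_comm_of_mem_center hz.mem_center, Units.inv_mul_cancel_left]
  map_eq h := by
    have h1 : σ h (↑u⁻¹ : F) * σ h u = 1 := by rw [← map_mul, Units.inv_mul, map_one]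
    rw [hz.map_eq, mul_smul_comm] at h1
    rw [torusChar_neg, ← Units.mul_left_inj u, smul_mul_assoc, Units.inv_mul, ← h1, smul_smul,
      Units.inv_mul, one_smul]

/-- The denominators of a weight vector form a stable ideal. -/
lemma IsWeightFraction.map_mul_eq (hσ : ∀ h a, σ h (ψ a) = ψ (ρ h a)) {g : Fin r → ℤ} {z : F}
    (hz : IsWeightFraction σ g z) {d b : A} (hd : z * ψ d = ψ b) (h : Torus k r) :
    z * ψ (ρ h d) = ψ (((torusChar g h)⁻¹ : kˣ) • ρ h b) := by
  have h1 := congrArg (σ h) hd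
  rw [map_mul, hz.map_eq, hσ, hσ, smul_mul_assoc] at h1
  rw [Units.smul_def, map_smul, ← h1, smul_smul, Units.inv_mul, one_smul]

/-- A stable ideal inside `P` lies in its core `J`, but the denominators are not contained in `J`.
Thus weight fractions can be evaluated at every prime of the stratum. -/
lemma IsWeightFraction.denominators_not_le (hψ : IsFract J ψ) (hJ : IsPrimeIdeal J)
    (hσ : ∀ h a, σ h (ψ a) = ψ (ρ h a)) {g : Fin r → ℤ} {z : F}
    (hz : IsWeightFraction σ g z) {P : TwoSidedIdeal A} (hP : core ρ P = J) :
    ¬ denominators ψ hz.mem_center ≤ P := by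
  intro hle
  refine hψ.denominators_not_le hJ hz.mem_center (hP ▸ IsStable.le_core (fun h d hd => ?_) hle)
  obtain ⟨b, hb⟩ := mem_denominators.1 hd
  exact mem_denominators.2 ⟨_, hz.map_mul_eq hσ hb h⟩

lemma IsWeightFraction.exists_notMem (hψ : IsFract J ψ) (hJ : IsPrimeIdeal J)
    (hσ : ∀ h a, σ h (ψ a) = ψ (ρ h a)) {g : Fin r → ℤ} {z : F}
    (hz : IsWeightFraction σ g z) {P : TwoSidedIdeal A} (hP : core ρ P = J) :
    ∃ d ∉ P, ∃ b, z * ψ d = ψ b := by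
  obtain ⟨d, hd, hdP⟩ := TwoSidedIdeal.exists_of_not_le (hz.denominators_not_le hψ hJ hσ hP)
  exact ⟨d, hdP, mem_denominators.1 hd⟩

/-- A weight vector that maps a denominator outside `P` into `P` vanishes. -/
lemma IsWeightFraction.eq_zero (hψ : IsFract J ψ) (hJ : IsPrimeIdeal J)
    (hσ : ∀ h a, σ h (ψ a) = ψ (ρ h a)) {g : Fin r → ℤ} {z : F}
    (hz : IsWeightFraction σ g z) {P : TwoSidedIdeal A} (hPprime : IsPrimeIdeal P)
    (hP : core ρ P = J) {d b : A} (hd : d ∉ P) (hb : b ∈ P) (hdb : z * ψ d = ψ b) : z = 0 := by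
  by_contra hz0
  obtain ⟨u, rfl⟩ := hψ.isUnit_of_mem_center hJ hz.mem_center hz0
  -- The inverse is again a weight vector, so it has a denominator `d'` outside `P`. Then `d' x d ≡
  -- b' x b` modulo `J`, which puts `d' A d` inside `P`.
  obtain ⟨d', hd', b', hb'⟩ := hz.inv.exists_notMem hψ hJ hσ hP
  obtain ⟨x, hx⟩ := hPprime.exists_mul_mul_notMem hd' hd
  refine hx ?_
  have h1 : ψ (d' * x * d) = ψ (b' * x * b) := by
    have h2 : ψ d' = u * ψ b' := by rw [← hb', Units.mul_inv_cancel_left]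
    simp only [map_mul]
    rw [h2, ← hdb, ← mul_comm_of_mem_center hz.mem_center]
    simp only [mul_assoc]
    rw [← mul_assoc (ψ x) (u : F), mul_comm_of_mem_center hz.mem_center (ψ x), mul_assoc]
  have h2 := P.add_mem (core_le (ρ := ρ) P (hP.symm ▸ hψ.map_eq_map_iff.1 h1))
    (P.mul_mem_left (b' * x) _ hb)
  rwa [sub_add_cancel] at h2

/-- Fixed central fractions are algebraic. -/
lemma IsWeightFraction.isAlgebraic (hA : SatisfiesNullstellensatz k A) (hψ : IsFract J ψ)
    (hJ : IsPrimeIdeal J) (hσ : ∀ h a, σ h (ψ a) = ψ (ρ h a)) {z : F}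
    (hz : IsWeightFraction σ 0 z) {P : TwoSidedIdeal A} (hP : P ∈ primStratum ρ J) :
    IsAlgebraic k z := by
  obtain ⟨p, hp, d, hd, b, hb, hdb⟩ := hA.exists_end hψ hP.1
    (hP.2.2 ▸ core_le (ρ := ρ) P) hz.mem_center (hz.denominators_not_le hψ hJ hσ hP.2.2)
  refine ⟨p, hp, IsWeightFraction.eq_zero (g := 0) hψ hJ hσ ⟨?_, fun h => ?_⟩ hP.2.1 hP.2.2 hd hb
    hdb⟩
  · rw [aeval_center hz.mem_center]
    exact SetLike.coe_mem _
  · rw [← Polynomial.aeval_algHom_apply, hz.map_eq, torusChar_zero, Units.val_one, one_smul,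
      one_smul]

/-- The central fraction `z` acts on `A / P` as the scalar `l`. -/
def ActsByScalar (ψ : A →ₐ[k] F) (P : TwoSidedIdeal A) (z : F) (l : k) : Prop :=
  ∀ d b, z * ψ d = ψ b → b - l • d ∈ P

lemma ActsByScalar.eq {P : TwoSidedIdeal A} {z : F} {l l' : k} (h : ActsByScalar ψ P z l)
    {d b : A} (hd : d ∉ P) (hdb : z * ψ d = ψ b) (hb : b - l' • d ∈ P) : l = l' := by
  by_contra hne
  have h1 := P.sub_mem hb (h d b hdb)
  rw [sub_sub_sub_cancel_left, ← sub_smul] at h1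
  have h2 := smul_mem_ideal P (l - l')⁻¹ h1
  rw [smul_smul, inv_mul_cancel₀ (sub_ne_zero.2 hne), one_smul] at h2
  exact hd h2

section AlgClosed

variable [IsAlgClosed k]

/-- An algebraic element over an algebraically closed field differs from a scalar by a
nonunit. -/
lemma exists_not_isUnit_algebraMap_sub {B : Type*} [Ring B] [Algebra k B] [Nontrivial B] {z : B}
    (hz : IsAlgebraic k z) : ∃ c : k, ¬ IsUnit (algebraMap k B c - z) := by
  obtain ⟨p, hp, hpz⟩ := hz
  rw [(IsAlgClosed.splits p).eq_prod_roots, map_mul, Polynomial.aeval_C] at hpz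
  obtain ⟨c, hc, -⟩ := spectrum.exists_mem_of_not_isUnit_aeval_prod (p := p) (a := z)
    fun hunit => by
      have h0 := (hunit.mul_left_eq_zero).1 hpz
      rw [map_eq_zero, Polynomial.leadingCoeff_eq_zero] at h0
      exact hp h0
  exact ⟨c, hc⟩

/-- By algebraicity some `c - z` is a nonunit; being central, it is zero. -/
lemma IsWeightFraction.exists_eq_algebraMap (hA : SatisfiesNullstellensatz k A)
    (hψ : IsFract J ψ) (hJ : IsPrimeIdeal J) (hσ : ∀ h a, σ h (ψ a) = ψ (ρ h a)) {z : F}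
    (hz : IsWeightFraction σ 0 z) {P : TwoSidedIdeal A} (hP : P ∈ primStratum ρ J) :
    ∃ c : k, z = algebraMap k F c := by
  have : Nontrivial F := ⟨⟨ψ 1, 0, fun h => hJ.one_notMem ((hψ.map_eq_zero_iff 1).1 h)⟩⟩
  obtain ⟨c, hc⟩ := exists_not_isUnit_algebraMap_sub (hz.isAlgebraic hA hψ hJ hσ hP)
  refine ⟨c, ?_⟩
  by_contra hne
  exact hc (hψ.isUnit_of_mem_center hJ (Subalgebra.sub_mem _ (Subalgebra.algebraMap_mem _ c)
    hz.mem_center) (sub_ne_zero.2 (Ne.symm hne)))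

lemma IsWeightFraction.exists_actsByScalar (hA : SatisfiesNullstellensatz k A)
    (hψ : IsFract J ψ) (hJ : IsPrimeIdeal J) (hσ : ∀ h a, σ h (ψ a) = ψ (ρ h a)) {g : Fin r → ℤ}
    {z : F} (hz : IsWeightFraction σ g z) {P : TwoSidedIdeal A} (hP : P ∈ primStratum ρ J) :
    ∃ l, ActsByScalar ψ P z l := by
  obtain ⟨hprim, -, hcore⟩ := hP
  obtain ⟨M, _, _, hM, hPM⟩ := hprim
  let _ : Module k M := Module.compHom M (algebraMap k A)
  have : IsScalarTower k A M := IsScalarTower.of_algebraMap_smul fun _ _ => rfl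
  have := IsSimpleModule.nontrivial A M
  obtain ⟨e, he⟩ := hψ.exists_end hPM (hcore ▸ core_le (ρ := ρ) P) hz.mem_center
    (hz.denominators_not_le hψ hJ hσ hcore)
  obtain ⟨l, hl⟩ := exists_not_isUnit_algebraMap_sub ((hA.2 M hM).isAlgebraic e)
  refine ⟨l, fun d b hdb => (hPM _).2 fun m => ?_⟩
  have h0 : algebraMap k (Module.End A M) l - e = 0 := by
    by_contra hne
    exact hl ((Module.End.isUnit_iff _).2 (LinearMap.bijective_of_ne_zero hne))
  rw [sub_smul, ← he d b hdb m, ← sub_eq_zero.1 h0, Module.algebraMap_end_apply, smul_assoc,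
    sub_self]

end AlgClosed

end WeightFractions

/-! ## Transitivity on the strata of primitive ideals -/

section Transitivity

/-- The multiplicative group of an algebraically closed field is divisible. -/
lemma exists_torusChar_eq_of_isAlgClosed {k : Type u} [Field k] [IsAlgClosed k] {r : ℕ}
    (Γ : AddSubgroup (Fin r → ℤ)) (q : Γ →+ Additive kˣ) :
    ∃ t : Torus k r, ∀ g : Γ, torusChar (g : Fin r → ℤ) t = (q g).toMul := by
  have hdiv : ∀ {n : ℕ}, n ≠ 0 → Function.Surjective fun x : Additive kˣ => n • x := by
    intro n hn x
    obtain ⟨y, hy⟩ := IsAlgClosed.exists_pow_nat_eq (x.toMul : k) (Nat.pos_of_ne_zero hn)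
    have hy0 : y ≠ 0 := by
      rintro rfl
      rw [zero_pow hn] at hy
      exact x.toMul.ne_zero hy.symm
    exact ⟨Additive.ofMul (Units.mk0 y hy0), Additive.toMul.injective (Units.ext hy)⟩
  -- Divisible groups are injective, so `q` extends to `ℤ^r`; its values on the standard basis are
  -- the coordinates of `t`.
  let _ : DivisibleBy (Additive kˣ) ℕ := divisibleByOfSMulRightSurj _ _ hdiv
  let _ : DivisibleBy (Additive kˣ) ℤ := AddGroup.divisibleByIntOfDivisibleByNat _
  obtain ⟨f, hf⟩ := (Module.Baer.of_divisible (Additive kˣ)).extension_property_addMonoidHom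
    Γ.subtype Γ.subtype_injective q
  refine ⟨fun i => (f (Pi.single i 1)).toMul, fun g => ?_⟩
  rw [← hf, AddMonoidHom.comp_apply, AddSubgroup.coe_subtype]
  conv_rhs => rw [← Finset.univ_sum_single (g : Fin r → ℤ)]
  rw [map_sum, torusChar_apply, toMul_sum]
  refine Finset.prod_congr rfl fun i _ => ?_
  rw [← toMul_zsmul, ← map_zsmul, ← Pi.single_smul, smul_eq_mul, mul_one]

variable {k : Type u} [Field k] {A : Type v} [Ring A] [Algebra k A] {r : ℕ}
  {ρ : Torus k r →* (A ≃ₐ[k] A)} {F : Type w} [Ring F] [Algebra k F] {J : TwoSidedIdeal A}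
  {ψ : A →ₐ[k] F} {σ : Torus k r → F →ₐ[k] F}

/-- The degrees of the invertible weight vectors. -/
def weightGroup (σ : Torus k r → F →ₐ[k] F) : AddSubgroup (Fin r → ℤ) where
  carrier := {g | ∃ u : Fˣ, IsWeightFraction σ g u}
  zero_mem' := ⟨1, Subalgebra.one_mem _, fun h => by simp [torusChar_zero]⟩
  add_mem' := fun ⟨u, hu⟩ ⟨v, hv⟩ => ⟨u * v, hu.mul hv⟩
  neg_mem' := fun ⟨u, hu⟩ => ⟨u⁻¹, hu.inv⟩

lemma IsWeightFraction.actsByScalar_mul (hψ : IsFract J ψ) (hJ : IsPrimeIdeal J)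
    (hσ : ∀ h a, σ h (ψ a) = ψ (ρ h a)) {g g' : Fin r → ℤ} {z z' : F}
    (hz : IsWeightFraction σ g z) (hz' : IsWeightFraction σ g' z') {P : TwoSidedIdeal A}
    (hP : P ∈ primStratum ρ J) {l l' l'' : k} (hl : ActsByScalar ψ P z l)
    (hl' : ActsByScalar ψ P z' l') (hl'' : ActsByScalar ψ P (z * z') l'') : l'' = l * l' := by
  obtain ⟨d, hd, b, hdb⟩ := hz.exists_notMem hψ hJ hσ hP.2.2
  obtain ⟨d', hd', b', hdb'⟩ := hz'.exists_notMem hψ hJ hσ hP.2.2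
  obtain ⟨x, hx⟩ := IsPrimeIdeal.exists_mul_mul_notMem hP.2.1 hd hd'
  refine hl''.eq (b := b * x * b') hx ?_ ?_
  · simp only [map_mul]
    rw [← hdb, ← hdb']
    simp only [mul_assoc]
    rw [← mul_assoc (ψ x) z', mul_comm_of_mem_center hz'.mem_center (ψ x), mul_assoc z' (ψ x),
      ← mul_assoc (ψ d) z', mul_comm_of_mem_center hz'.mem_center (ψ d), mul_assoc]
  · have h1 : b * x * b' - (l * l') • (d * x * d') =
        (b - l • d) * (x * b') + (l • d * x) * (b' - l' • d') := by
      simp only [sub_mul, mul_sub, smul_mul_assoc, mul_smul_comm, smul_smul, mul_assoc]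
      rw [mul_comm l' l]
      abel
    rw [h1]
    exact P.add_mem (P.mul_mem_right _ _ (hl d b hdb)) (P.mul_mem_left _ _ (hl' d' b' hdb'))

lemma IsWeightFraction.actsByScalar_ne_zero (hψ : IsFract J ψ) (hJ : IsPrimeIdeal J)
    (hσ : ∀ h a, σ h (ψ a) = ψ (ρ h a)) {g : Fin r → ℤ} {z : F}
    (hz : IsWeightFraction σ g z) (hz0 : z ≠ 0) {P : TwoSidedIdeal A}
    (hP : P ∈ primStratum ρ J) {l : k} (hl : ActsByScalar ψ P z l) : l ≠ 0 := by
  rintro rfl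
  obtain ⟨d, hd, b, hdb⟩ := hz.exists_notMem hψ hJ hσ hP.2.2
  have h1 := hl d b hdb
  rw [zero_smul, sub_zero] at h1
  exact hz0 (hz.eq_zero hψ hJ hσ hP.2.1 hP.2.2 hd h1 hdb)

lemma ActsByScalar.smul_eq (hψ : IsFract J ψ) (hJ : IsPrimeIdeal J)
    (hσ : ∀ h a, σ h (ψ a) = ψ (ρ h a)) {g : Fin r → ℤ} {z : F}
    (hz : IsWeightFraction σ g z) {P : TwoSidedIdeal A} (hP : P ∈ primStratum ρ J) {c l l' : k}
    (hl : ActsByScalar ψ P z l) (hl' : ActsByScalar ψ P (c • z) l') : l' = c * l := by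
  obtain ⟨d, hd, b, hdb⟩ := hz.exists_notMem hψ hJ hσ hP.2.2
  refine hl'.eq (b := c • b) hd (by rw [smul_mul_assoc, hdb, map_smul]) ?_
  rw [mul_smul, ← smul_sub]
  exact smul_mem_ideal P c (hl d b hdb)

/-- The scalars by which central weight vectors act transform under translation of the
primitive ideal. -/
lemma ActsByScalar.translate (hσ : ∀ h a, σ h (ψ a) = ψ (ρ h a)) {g : Fin r → ℤ} {z : F}
    (hz : IsWeightFraction σ g z) {P : TwoSidedIdeal A} {l : k} (hl : ActsByScalar ψ P z l)
    (t : Torus k r) :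
    ActsByScalar ψ (translate ρ t⁻¹ P) z ((torusChar g t : k) * l) := by
  intro d b hdb
  rw [mem_translate, inv_inv]
  have h1 := smul_mem_ideal P (torusChar g t : k) (hl _ _ (hz.map_mul_eq hσ hdb t))
  rwa [smul_sub, Units.smul_def, smul_smul, Units.mul_inv, one_smul, smul_smul, ← map_smul,
    ← map_sub] at h1

variable [IsAlgClosed k]

/-- The ratio of the scalars by which the weight vectors of a given weight act modulo two
primitive ideals of a stratum. -/
lemma exists_ratio (hA : SatisfiesNullstellensatz k A) (hψ : IsFract J ψ) (hJ : IsPrimeIdeal J)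
    (hσ : ∀ h a, σ h (ψ a) = ψ (ρ h a)) {P P' : TwoSidedIdeal A} (hP : P ∈ primStratum ρ J)
    (hP' : P' ∈ primStratum ρ J) (g : weightGroup σ) :
    ∃ q : kˣ, ∀ z, IsWeightFraction σ (g : Fin r → ℤ) z → ∀ l l', ActsByScalar ψ P z l →
      ActsByScalar ψ P' z l' → l' = q * l := by
  have : Nontrivial F := ⟨⟨ψ 1, 0, fun h => hJ.one_notMem ((hψ.map_eq_zero_iff 1).1 h)⟩⟩
  obtain ⟨g, u, hu⟩ := g
  obtain ⟨l₀, hl₀⟩ := hu.exists_actsByScalar hA hψ hJ hσ hP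
  obtain ⟨l₀', hl₀'⟩ := hu.exists_actsByScalar hA hψ hJ hσ hP'
  have h0 := hu.actsByScalar_ne_zero hψ hJ hσ u.ne_zero hP hl₀
  have h0' := hu.actsByScalar_ne_zero hψ hJ hσ u.ne_zero hP' hl₀'
  refine ⟨Units.mk0 (l₀' / l₀) (div_ne_zero h0' h0), fun z hz l l' hl hl' => ?_⟩
  -- The quotient `z u⁻¹` has weight zero and is thus a scalar. So `z` is a multiple of `u`, and its
  -- ratio is that of `u`.
  obtain ⟨c, hc⟩ := IsWeightFraction.exists_eq_algebraMap hA hψ hJ hσ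
    (add_neg_cancel g ▸ hz.mul hu.inv) hP
  have hzc : z = c • (u : F) := by
    rw [Algebra.smul_def, ← hc, Units.inv_mul_cancel_right]
  subst hzc
  rw [hl₀.smul_eq hψ hJ hσ hu hP hl, hl₀'.smul_eq hψ hJ hσ hu hP' hl', Units.val_mk0]
  field_simp

/-- After a translation, two primitive ideals of a stratum have the same scalars. -/
lemma exists_translate_actsByScalar (hA : SatisfiesNullstellensatz k A) (hψ : IsFract J ψ)
    (hJ : IsPrimeIdeal J) (hσ : ∀ h a, σ h (ψ a) = ψ (ρ h a)) {P P' : TwoSidedIdeal A}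
    (hP : P ∈ primStratum ρ J) (hP' : P' ∈ primStratum ρ J) :
    ∃ t : Torus k r, ∀ g z, IsWeightFraction σ g z → ∀ l', ActsByScalar ψ P' z l' →
      ActsByScalar ψ (translate ρ t P) z l' := by
  have : Nontrivial F := ⟨⟨ψ 1, 0, fun h => hJ.one_notMem ((hψ.map_eq_zero_iff 1).1 h)⟩⟩
  choose q hq using exists_ratio hA hψ hJ hσ hP hP'
  have hadd : ∀ g g', q (g + g') = q g * q g' := by
    rintro ⟨g, u, hu⟩ ⟨g', u', hu'⟩
    obtain ⟨l₁, hl₁⟩ := hu.exists_actsByScalar hA hψ hJ hσ hP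
    obtain ⟨l₁', hl₁'⟩ := hu.exists_actsByScalar hA hψ hJ hσ hP'
    obtain ⟨l₂, hl₂⟩ := hu'.exists_actsByScalar hA hψ hJ hσ hP
    obtain ⟨l₂', hl₂'⟩ := hu'.exists_actsByScalar hA hψ hJ hσ hP'
    obtain ⟨l₃, hl₃⟩ := (hu.mul hu').exists_actsByScalar hA hψ hJ hσ hP
    obtain ⟨l₃', hl₃'⟩ := (hu.mul hu').exists_actsByScalar hA hψ hJ hσ hP'
    have h1 := hq ⟨g, u, hu⟩ _ hu _ _ hl₁ hl₁'
    have h2 := hq ⟨g', u', hu'⟩ _ hu' _ _ hl₂ hl₂'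
    have h3 := hq (⟨g, u, hu⟩ + ⟨g', u', hu'⟩) _ (hu.mul hu') _ _ hl₃ hl₃'
    have h4 := hu.actsByScalar_mul hψ hJ hσ hu' hP hl₁ hl₂ hl₃
    have h5 := hu.actsByScalar_mul hψ hJ hσ hu' hP' hl₁' hl₂' hl₃'
    have h6 := hu.actsByScalar_ne_zero hψ hJ hσ u.ne_zero hP hl₁
    have h7 := hu'.actsByScalar_ne_zero hψ hJ hσ u'.ne_zero hP hl₂
    refine Units.ext (mul_right_cancel₀ (mul_ne_zero h6 h7) ?_)
    rw [← h4, ← h3, h5, h1, h2, h4, Units.val_mul]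
    ring
  obtain ⟨t, ht⟩ := exists_torusChar_eq_of_isAlgClosed (weightGroup σ)
    (AddMonoidHom.mk' (fun g => Additive.ofMul (q g)) fun g g' => congrArg _ (hadd g g'))
  refine ⟨t⁻¹, fun g z hz l' hl' => ?_⟩
  obtain ⟨l, hl⟩ := hz.exists_actsByScalar hA hψ hJ hσ hP
  rcases eq_or_ne z 0 with rfl | hz0
  -- The ratio is defined only for weights of invertible vectors, so `z = 0` is treated apart; it
  -- acts by the scalar zero.
  · have hzero : ∀ {l : k} {P : TwoSidedIdeal A}, P ∈ primStratum ρ J →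
        ActsByScalar ψ P (0 : F) l → l = 0 := fun hP hl =>
      hl.eq (b := 0) (IsPrimeIdeal.one_notMem hP.2.1) (by simp) (by simp)
    rw [hzero hP' hl']
    intro d b hdb
    rw [zero_mul] at hdb
    rw [zero_smul, sub_zero]
    refine core_le (ρ := ρ) _ ?_
    rw [core_translate, hP.2.2]
    exact (hψ.map_eq_zero_iff b).1 hdb.symm
  obtain ⟨u, rfl⟩ := hψ.isUnit_of_mem_center hJ hz.mem_center hz0
  rw [hq ⟨g, u, hz⟩ _ hz _ _ hl hl']
  have := hl.translate hσ hz t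
  rwa [ht ⟨g, u, hz⟩] at this

/-- Two primitive ideals of a stratum with the same scalars are comparable. -/
lemma le_of_actsByScalar [Infinite k] (hρ : IsRationalAction ρ)
    (hA : SatisfiesNullstellensatz k A) (hψ : IsFract J ψ)
    (hJ : IsHPrime ρ J) (hσ : ∀ h a, σ h (ψ a) = ψ (ρ h a)) {P P' : TwoSidedIdeal A}
    (hP : P ∈ primStratum ρ J) (hP' : P' ∈ primStratum ρ J)
    (h : ∀ g z, IsWeightFraction σ g z → ∀ l', ActsByScalar ψ P' z l' → ActsByScalar ψ P z l') :
    P' ≤ P := by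
  by_contra hle
  let _ := weightGrading hρ
  have hJprime := hJ.isPrimeIdeal hρ
  obtain ⟨u, hu, huP, g₀, hg₀, hW⟩ := exists_minimal_element (𝒜 := weightSpace ρ)
    (IsPrimitiveIdeal.isPrimeIdeal hP.1) (J := J)
    (hP.2.2 ▸ core_le (ρ := ρ) P) (hP'.2.2 ▸ core_le (ρ := ρ) P')
    (fun a ha i => hJ.2.1.proj_mem hρ ha i)
    (fun i a ha haP => hP.2.2 ▸ mem_core_of_mem_weightSpace ha haP) hle
  set s := gradedSupport (weightSpace ρ) u
  let U : (Fin r → ℤ) → A := fun g => GradedRing.proj (weightSpace ρ) g u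
  have hU : ∀ g, U g ∈ weightSpace ρ g := fun g => TorusStrat.proj_mem (weightSpace ρ) u g
  have hUσ : ∀ g t, σ t (ψ (U g)) = (torusChar g t : k) • ψ (U g) := fun g t => by
    rw [hσ, hU g t, map_smul]
  -- The central fraction `u_g / u_{g₀}` has weight `g - g₀`, so by hypothesis it acts by the same
  -- scalar modulo `P'` and modulo `P`.
  have key : ∀ g ∈ s, ∃ l : k, U g - l • U g₀ ∈ P' ∧ U g - l • U g₀ ∈ P := by
    intro g hg
    let T : AddSubgroup (A × A) := (diagonalFamilies (weightSpace ρ) P' s).map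
      { toFun := fun y => (y g₀, y g), map_zero' := rfl, map_add' := fun y y' => rfl }
    have huT : (U g₀, U g) ∈ T := ⟨_, proj_mem_diagonalFamilies hu, rfl⟩
    obtain ⟨z, hz, hzT⟩ := hψ.exists_central T
      (by rintro a _ ⟨y, hy, rfl⟩; exact ⟨_, diagonalFamilies_mul_left hy a, rfl⟩)
      (by rintro a _ ⟨y, hy, rfl⟩; exact ⟨_, diagonalFamilies_mul_right hy a, rfl⟩)
      (by rintro _ ⟨y, hy, rfl⟩ h; exact hW y hy h g hg) ⟨_, huT, hg₀⟩
    have hzu : z * ψ (U g₀) = ψ (U g) := hzT _ huT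
    have hweight : IsWeightFraction σ (g - g₀) z := by
      refine ⟨hz, fun t => ?_⟩
      have hc : σ t z ∈ Subalgebra.center k F := hψ.mem_center fun a => by
        rw [← action_inv_apply (ρ := ρ) t a, ← hσ, ← map_mul, ← map_mul,
          mul_comm_of_mem_center hz]
      rw [← sub_eq_zero]
      refine hψ.eq_zero_of_mul_eq_zero hJprime
        (Subalgebra.sub_mem _ hc (Subalgebra.smul_mem _ hz _)) hg₀ ?_
      have h1 := congrArg (σ t) hzu
      rw [map_mul, hUσ, hUσ, mul_smul_comm] at h1
      change (_ - _) * ψ (U g₀) = 0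
      rw [sub_mul, smul_mul_assoc, hzu, sub_eq_zero, sub_eq_add_neg, torusChar_add, torusChar_neg,
        mul_comm, Units.val_mul, mul_smul, ← h1, smul_smul, Units.inv_mul, one_smul]
    obtain ⟨l, hl⟩ := hweight.exists_actsByScalar hA hψ hJprime hσ hP'
    exact ⟨l, hl _ _ hzu, h _ _ hweight _ hl _ _ hzu⟩
  choose! l hlP' hlP using key
  have hsum : ∑ g ∈ s, (U g - l g • U g₀) = u - (∑ g ∈ s, l g) • U g₀ := by
    rw [Finset.sum_sub_distrib, Finset.sum_smul, sum_proj _ subset_rfl]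
  have h1 := P'.finsetSum_mem s _ hlP'
  have h2 := P.finsetSum_mem s _ hlP
  rw [hsum] at h1 h2
  have h3 := P'.sub_mem hu h1
  rw [sub_sub_cancel] at h3
  -- Since `u ∈ P'`, the multiple `(∑ l_g) u_{g₀}` lies in `P'`, while `u_{g₀}` does not. Once the
  -- sum of scalars vanishes, the relation modulo `P` reads `u ∈ P`.
  have h4 : ∑ g ∈ s, l g = 0 := by
    by_contra hne
    have h5 := smul_mem_ideal P' (∑ g ∈ s, l g)⁻¹ h3
    rw [smul_smul, inv_mul_cancel₀ hne, one_smul] at h5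
    exact hg₀ (hP'.2.2 ▸ mem_core_of_mem_weightSpace (hU g₀) h5)
  rw [h4, zero_smul, sub_zero] at h2
  exact huP h2

end Transitivity

/-! ## The induced action on the ring of fractions -/

section FixedCenter

variable {k : Type u} [Field k] {A : Type v} [Ring A] [Algebra k A] {H : Type*} [Group H]
  {ρ : H →* (A ≃ₐ[k] A)}

lemma fractMap_toFract {J : TwoSidedIdeal A} (hJ : IsStable ρ J)
    [OreLocalization.OreSet (J.ringCon.Quotient)⁰] (h : H) (a : A) :
    fractMap (quotientAut hJ h : J.ringCon.Quotient ≃+* J.ringCon.Quotient) (toFract k J a) =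
      toFract k J (ρ h a) :=
  OreLocalization.universalHom_commutes ..

/-- The induced automorphisms of the ring of fractions, as `k`-algebra homomorphisms. -/
def fractAlgHom {J : TwoSidedIdeal A} (hJ : IsStable ρ J)
    [OreLocalization.OreSet (J.ringCon.Quotient)⁰] (h : H) :
    OreLocalization (J.ringCon.Quotient)⁰ J.ringCon.Quotient →ₐ[k]
      OreLocalization (J.ringCon.Quotient)⁰ J.ringCon.Quotient where
  __ := fractMap (quotientAut hJ h : J.ringCon.Quotient ≃+* J.ringCon.Quotient)
  commutes' c := by
    have h1 := fractMap_toFract hJ h (algebraMap k A c)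
    rw [AlgEquiv.commutes, AlgHom.commutes] at h1
    exact h1

lemma mem_fixedCenter {r : ℕ} {ρ : Torus k r →* (A ≃ₐ[k] A)} {J : TwoSidedIdeal A}
    (hJ : IsStable ρ J) [OreLocalization.OreSet (J.ringCon.Quotient)⁰]
    {z : OreLocalization (J.ringCon.Quotient)⁰ J.ringCon.Quotient} :
    z ∈ fixedCenter hJ ↔ IsWeightFraction (fractAlgHom hJ) 0 z := by
  rw [fixedCenter, Subring.mem_inf, Subring.mem_iInf]
  constructor
  · rintro ⟨h1, h2⟩
    exact ⟨Subalgebra.mem_center_iff.2 (Subring.mem_center_iff.1 h1), fun h => by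
      rw [torusChar_zero, Units.val_one, one_smul]
      exact h2 h⟩
  · rintro ⟨h1, h2⟩
    refine ⟨Subring.mem_center_iff.2 (Subalgebra.mem_center_iff.1 h1), fun h => ?_⟩
    have h3 := h2 h
    rw [torusChar_zero, Units.val_one, one_smul] at h3
    exact h3

end FixedCenter

end TorusStrat

end

/-! ### Assembly of the three statements -/

theorem theorem5p5 {k : Type*} [Field k] [Infinite k] {A : Type*} [Ring A] [Algebra k A]
    (hnoeth : TorusStrat.IsTwoSidedNoetherian A)
    (hnull : TorusStrat.SatisfiesNullstellensatz k A)
    {r : ℕ} (ρ : TorusStrat.Torus k r →* (A ≃ₐ[k] A))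
    (hρ : TorusStrat.IsRationalAction ρ)
    (hfin : (TorusStrat.HSpec ρ).Finite)
    (hsep : TorusStrat.HasNormalHSeparation ρ) :
    (TorusStrat.DixmierMoeglinEquivalence k A ∧
      TorusStrat.prim A =
        {P | ∃ J ∈ TorusStrat.HSpec ρ, Maximal (· ∈ TorusStrat.specStratum ρ J) P}) ∧
    (∀ (J : TwoSidedIdeal A) (hJ : TorusStrat.IsHPrime ρ J),
      ∃ _ : OreLocalization.OreSet (nonZeroDivisors J.ringCon.Quotient),
        IsField (TorusStrat.fixedCenter hJ.2.1) ∧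
          ∀ z ∈ TorusStrat.fixedCenter hJ.2.1, IsAlgebraic k z) ∧
    (IsAlgClosed k → ∀ J ∈ TorusStrat.HSpec ρ,
      ∃ P ∈ TorusStrat.primStratum ρ J,
        TorusStrat.primStratum ρ J = Set.range (fun h => TorusStrat.translate ρ h P)) := by
  open TorusStrat in
  have hprim : ∀ {P : TwoSidedIdeal A}, IsPrimitiveIdeal P →
      Maximal (· ∈ specStratum ρ (core ρ P)) P := fun hP =>
    (hP.isRationalPrime hnoeth hnull).maximal hρ hnoeth
  refine ⟨⟨⟨?_, ?_⟩, ?_⟩, fun J hJ => ?_, fun _ J hJ => ?_⟩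
  · ext P
    exact ⟨fun hP => isLocallyClosedPrime_of_maximal hfin
      (IsRationalPrime.maximal hρ hnoeth hP),
      fun hP => (IsLocallyClosedPrime.isPrimitiveIdeal hnull.1 hP).isRationalPrime hnoeth hnull⟩
  · ext P
    exact ⟨fun hP => IsLocallyClosedPrime.isPrimitiveIdeal hnull.1 hP,
      fun hP => isLocallyClosedPrime_of_maximal hfin (hprim hP)⟩
  · ext P
    refine ⟨fun hP => ⟨core ρ P, (IsPrimitiveIdeal.isPrimeIdeal hP).isHPrime_core, hprim hP⟩, ?_⟩
    rintro ⟨J, -, hP⟩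
    exact (isLocallyClosedPrime_of_maximal hfin hP).isPrimitiveIdeal hnull.1
  · have hprime := hJ.isPrimeIdeal hρ
    obtain ⟨inst⟩ := hprime.nonempty_oreSet hnoeth
    have hψ : IsFract J (toFract k J) := isFract_toFract hnoeth hprime
    have hσ := fractMap_toFract hJ.2.1
    refine ⟨inst, ⟨?_, fun x y => ?_, fun {x} hx => ?_⟩, fun z hz => ?_⟩
    · refine ⟨0, 1, fun h => hprime.one_notMem ((hψ.map_eq_zero_iff 1).1 ?_)⟩
      rw [map_one]
      exact (congrArg Subtype.val h).symm
    · exact Subtype.ext (mul_comm_of_mem_center ((mem_fixedCenter hJ.2.1).1 y.2).mem_center x)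
    · have hx' := (mem_fixedCenter hJ.2.1).1 x.2
      obtain ⟨u, hu⟩ := hψ.isUnit_of_mem_center hprime hx'.mem_center
        fun h => hx (Subtype.ext h)
      rw [← hu] at hx'
      have hinv := hx'.inv
      rw [neg_zero] at hinv
      exact ⟨⟨_, (mem_fixedCenter hJ.2.1).2 hinv⟩,
        Subtype.ext ((congrArg (· * _) hu.symm).trans u.mul_inv)⟩
    · obtain ⟨P, hP⟩ := exists_mem_primStratum hρ hnull.1 hfin hJ
      exact ((mem_fixedCenter hJ.2.1).1 hz).isAlgebraic hnull hψ hprime hσ hP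
  · have hJ' : IsHPrime ρ J := hJ
    have hprime := hJ'.isPrimeIdeal hρ
    obtain ⟨inst⟩ := hprime.nonempty_oreSet hnoeth
    have hψ : IsFract J (toFract k J) := isFract_toFract hnoeth hprime
    have hσ : ∀ h a, fractAlgHom hJ'.2.1 h (toFract k J a) = toFract k J (ρ h a) :=
      fractMap_toFract hJ'.2.1
    obtain ⟨P, hP⟩ := exists_mem_primStratum hρ hnull.1 hfin hJ'
    refine ⟨P, hP, subset_antisymm (fun P' hP' => ?_) ?_⟩
    · obtain ⟨t, ht⟩ := exists_translate_actsByScalar hnull hψ hprime hσ hP hP'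
      have hPt := translate_mem_primStratum hP t
      have hle := le_of_actsByScalar hρ hnull hψ hJ' hσ hPt hP' ht
      have hmax := hprim hP'.1
      rw [hP'.2.2] at hmax
      -- The primitive ideal `P'` is maximal in its stratum, which also contains the translate of
      -- `P`, so the inclusion is an equality.
      exact ⟨t, le_antisymm (hmax.2 hPt.2 hle) hle⟩
    · rintro _ ⟨h, rfl⟩
      exact translate_mem_primStratum hP h
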